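/- Let $\Sigma$ be a $2$-polygraph: a directed graph $(\Sigma_0,\Sigma_1)$ together with a set $\Sigma_2$ of $2$-cells $\varphi : p \Rightarrow q$, each between two parallel $1$-cells of the free category $\Sigma_1^*$. Let $\Sigma_2^*$ and $\Sigma_2^\top$ be the free $2$-category and the free $(2,1)$-category generated by $\Sigma$, with $0$-composition written as juxtaposition and $1$-composition written $\star_1$. A rewriting step is a $2$-cell $u\varphi v$ with $\varphi\in\Sigma_2$ and $u,v\in\Sigma_1^*$; rewriting sequences $f_1\cdots f_n$ are finite, possibly empty, composable sequences of steps. $\Sigma$ is quasi-convergent if it is confluent (any two rewriting sequences $u\Rightarrow v$, $u\Rightarrow w$ can be continued to a common target) and quasi-terminating (for every infinite sequence $(u_n)$ with a rewriting step from each $u_n$ to $u_{n+1}$, some $1$-cell occurs infinitely often among the $u_n$). Let $(W,\prec)$ be a well-founded partially ordered set and $\psi$ a map from the rewriting steps of $\Sigma$ to $W$. * A local branching is a pair $(f,g)$ of rewriting steps with the same source. A confluence diagram $(f\cdot f',g\cdot g')$ of it, with $f',g'$ rewriting sequences having the same target, is strictly decreasing if all labels of steps in $f'$ are $\prec\psi(f)$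 and all labels of steps in $g'$ are $\prec\psi(g)$. $(\Sigma,\psi)$ is strictly decreasing if every local branching has a strictly decreasing confluence diagram. * $\psi$ is compatible with contexts if, for every strictly decreasing confluence diagram $(f\cdot f',g\cdot g')$ of a local branching and all composable $1$-cells $u_1,u_2$, the diagram $(u_1fu_2\cdot u_1f'u_2,\;u_1gu_2\cdot u_1g'u_2)$ is strictly decreasing. * A Peiffer branching is a local branching $(fv,ug)$ (up to order) with $f:u\Rightarrow u'$ and $g:v\Rightarrow v'$ rewriting steps. A critical branching is a local branching $(f,g)$ with $f\neq g$ that is not Peiffer and is minimal for the order given by $(f,g)\sqsubseteq(wfw',wgw')$. * A $2$-loop is a $2$-cell $f$ of $\Sigma_2^*$ with equal source and target. Equivalence of $2$-loops is the equivalence relation generated by $f\star_1 g\sim g\star_1 f$. A $2$-loop $f$ is elementary if it is not an identity, if every decomposition $f=g\star_1h\star_1k$ with $h$ a $2$-loop has $h$ an identity or $h=f$, and if $f$ is not of the form $ugv$ with $g$ a $2$-loop and $u,v$ $1$-cells that are not both identities. * A strictly decreasing Squier completion of $(\Sigma,\psi)$ consists of a $3$-cell $f\star_1f'\Rrightarrow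 g\star_1g'$ for each critical branching $(f,g)$ (taken in one or both of its orders), where $(f\cdot f',g\cdot g')$ is a chosen strictly decreasing confluence diagram, and of a $3$-cell $\alpha\Rrightarrow 1$ for one chosen elementary $2$-loop $\alpha$ in each equivalence class of elementary $2$-loops. * For a set $\Gamma$ of $3$-cells between parallel $2$-cells of $\Sigma_2^\top$, let $\equiv_\Gamma$ be the congruence on $2$-cells of $\Sigma_2^\top$ generated by $\Gamma$. $(\Sigma,\psi)$ is Peiffer decreasing with respect to $\Gamma$ if for all rewriting steps $f:u\Rightarrow u'$, $g:v\Rightarrow v'$ with $u,v$ composable, the branching $(fv,ug)$ has a strictly decreasing confluence diagram $(fv\cdot f',ug\cdot g')$ such that $u'g\star_1(fv')^-\equiv_\Gamma f'\star_1(g')^-$. * $\Gamma$ is a homotopy basis of $\Sigma_2^\top$ if for any two parallel $2$-cells $f,g$ of $\Sigma_2^\top$ there is a $3$-cell $f\Rrightarrow g$ in the free $(3,1)$-category generated by $(\Sigma,\Gamma)$. $\Sigma$ has finite derivation type if $\Sigma_2^\top$ has a finite homotopy basis. **Proposition.** Let $(\Sigma,\psi)$ be strictly decreasing and $\Sigma$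 quasi-convergent, let $\psi$ be compatible with contexts, and let $(\Sigma,\psi)$ be Peiffer decreasing with respect to some strictly decreasing Squier completion of $(\Sigma,\psi)$. If $\Sigma$ has finitely many $2$-cells and finitely many equivalence classes of elementary $2$-loops, then $\Sigma$ has finite derivation type. -/

import Mathlib

universe u v w t

/-- A `1`-polygraph: a directed graph, with `Gen x y` the set of generating `1`-cells `x → y`. -/
structure OnePolygraph where
  Obj : Type u
  Gen : Obj → Obj → Type v

instance OnePolygraph.instQuiver (Q : OnePolygraph.{u, v}) : Quiver Q.Obj := ⟨Q.Gen⟩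

/-- The `1`-cells `x → y` of the free category over a `1`-polygraph: composable paths of
generating `1`-cells, with `Quiver.Path.comp` as composition and `Quiver.Path.nil` as identity. -/
abbrev OnePolygraph.Cell1 (Q : OnePolygraph.{u, v}) (x y : Q.Obj) : Type (max u v) :=
  Quiver.Path x y

/-- A `2`-polygraph: a `1`-polygraph together with a set of `2`-cells, each with a source and a
target which are parallel `1`-cells of the free category. `Rule p q` is the set of the `2`-cells
with source `p` and target `q`. -/
structure TwoPolygraph extends OnePolygraph.{u, v} where
  Rule : {x y : Obj} → toOnePolygraph.Cell1 x y → toOnePolygraph.Cell1 x y → Type w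

namespace TwoPolygraph

variable {P : TwoPolygraph.{u, v, w}}

/-- The set `Σ₂` of all `2`-cells of a `2`-polygraph. -/
def AllRules (P : TwoPolygraph.{u, v, w}) : Type (max u v w) :=
  Σ (x : P.Obj) (y : P.Obj) (p : P.Cell1 x y) (q : P.Cell1 x y), P.Rule p q

/-! ## Rewriting steps and rewriting sequences -/

/-- A rewriting step `l φ r` from `u` to `v`, where `φ` is a `2`-cell of the polygraph. -/
structure Step {x y : P.Obj} (u v : P.Cell1 x y) where
  {a : P.Obj}
  {b : P.Obj}
  {p : P.Cell1 a b}
  {q : P.Cell1 a b}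
  l : P.Cell1 x a
  φ : P.Rule p q
  r : P.Cell1 b y
  src_eq : u = (l.comp p).comp r
  tgt_eq : v = (l.comp q).comp r

/-- `c f`, for a `1`-cell `c` and a rewriting step `f`. -/
def Step.whiskerLeft {x y z : P.Obj} (c : P.Cell1 z x) {u v : P.Cell1 x y} (f : Step u v) :
    Step (c.comp u) (c.comp v) where
  l := c.comp f.l
  φ := f.φ
  r := f.r
  src_eq := by simp only [congrArg (Quiver.Path.comp c) f.src_eq, Quiver.Path.comp_assoc]
  tgt_eq := by simp only [congrArg (Quiver.Path.comp c) f.tgt_eq, Quiver.Path.comp_assoc]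

/-- `f c`, for a `1`-cell `c` and a rewriting step `f`. -/
def Step.whiskerRight {x y z : P.Obj} {u v : P.Cell1 x y} (f : Step u v) (c : P.Cell1 y z) :
    Step (u.comp c) (v.comp c) where
  l := f.l
  φ := f.φ
  r := f.r.comp c
  src_eq := by
    simp only [congrArg (fun e => Quiver.Path.comp e c) f.src_eq, Quiver.Path.comp_assoc]
  tgt_eq := by
    simp only [congrArg (fun e => Quiver.Path.comp e c) f.tgt_eq, Quiver.Path.comp_assoc]

/-- Finite (possibly empty) rewriting sequences from `u` to `v`. -/
inductive RSeq {x y : P.Obj} : P.Cell1 x y → P.Cell1 x y → Type (max u v w)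
  | nil (u : P.Cell1 x y) : RSeq u u
  | cons {u v w : P.Cell1 x y} (f : Step u v) (s : RSeq v w) : RSeq u w

namespace RSeq

/-- Concatenation of rewriting sequences. -/
def append {x y : P.Obj} {u v w : P.Cell1 x y} : RSeq u v → RSeq v w → RSeq u w
  | nil _, s => s
  | cons f r, s => cons f (append r s)

def whiskerLeft {x y z : P.Obj} (c : P.Cell1 z x) {u v : P.Cell1 x y} :
    RSeq u v → RSeq (c.comp u) (c.comp v)
  | nil u => nil (c.comp u)
  | cons f s => cons (f.whiskerLeft c) (whiskerLeft c s)

def whiskerRight {x y z : P.Obj} {u v : P.Cell1 x y} (s : RSeq u v) (c : P.Cell1 y z) :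
    RSeq (u.comp c) (v.comp c) :=
  match s with
  | nil u => nil (u.comp c)
  | cons f s => cons (f.whiskerRight c) (whiskerRight s c)

end RSeq

/-! ## Peiffer relations, the free `2`-category and the free `(2,1)`-category -/

/-- The rewriting steps `a`, `b`, `c`, `d` form a square
`a = l φ (m p' r)`, `b = (l q m) χ r`, `c = (l p m) χ r`, `d = l φ (m q' r)`, where
`φ : p ⇒ q` and `χ : p' ⇒ q'` are `2`-cells of the polygraph acting on disjoint factors of the
word `l p m p' r`. -/
inductive PeifferSquare {x y : P.Obj} {u₀ u₁ u₂ u₃ : P.Cell1 x y} :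
    Step u₀ u₁ → Step u₁ u₃ → Step u₀ u₂ → Step u₂ u₃ → Prop
  | mk {i j k n : P.Obj} {p q : P.Cell1 i j} {p' q' : P.Cell1 k n}
      (l : P.Cell1 x i) (φ : P.Rule p q) (m : P.Cell1 j k) (χ : P.Rule p' q') (r : P.Cell1 n y)
      {ra rd : P.Cell1 j y} {lb lc : P.Cell1 x k}
      (hra : ra = (m.comp p').comp r) (hrd : rd = (m.comp q').comp r)
      (hlb : lb = (l.comp q).comp m) (hlc : lc = (l.comp p).comp m)
      (sa : u₀ = (l.comp p).comp ra) (ta : u₁ = (l.comp q).comp ra)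
      (sb : u₁ = (lb.comp p').comp r) (tb : u₃ = (lb.comp q').comp r)
      (sc : u₀ = (lc.comp p').comp r) (tc : u₂ = (lc.comp q').comp r)
      (sd : u₂ = (l.comp p).comp rd) (td : u₃ = (l.comp q).comp rd) :
      PeifferSquare ⟨l, φ, ra, sa, ta⟩ ⟨lb, χ, r, sb, tb⟩ ⟨lc, χ, r, sc, tc⟩ ⟨l, φ, rd, sd, td⟩

theorem PeifferSquare.whiskerLeft {x y z : P.Obj} (e : P.Cell1 z x)
    {u₀ u₁ u₂ u₃ : P.Cell1 x y} {a : Step u₀ u₁} {b : Step u₁ u₃} {c : Step u₀ u₂}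
    {d : Step u₂ u₃} (h : PeifferSquare a b c d) :
    PeifferSquare (a.whiskerLeft e) (b.whiskerLeft e) (c.whiskerLeft e) (d.whiskerLeft e) := by
  obtain ⟨l, φ, m, χ, r, hra, hrd, hlb, hlc, sa, ta, sb, tb, sc, tc, sd, td⟩ := h
  exact .mk (e.comp l) φ m χ r hra hrd (by simp only [hlb, Quiver.Path.comp_assoc])
    (by simp only [hlc, Quiver.Path.comp_assoc]) _ _ _ _ _ _ _ _

theorem PeifferSquare.whiskerRight {x y z : P.Obj} (e : P.Cell1 y z)
    {u₀ u₁ u₂ u₃ : P.Cell1 x y} {a : Step u₀ u₁} {b : Step u₁ u₃} {c : Step u₀ u₂}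
    {d : Step u₂ u₃} (h : PeifferSquare a b c d) :
    PeifferSquare (a.whiskerRight e) (b.whiskerRight e) (c.whiskerRight e)
      (d.whiskerRight e) := by
  obtain ⟨l, φ, m, χ, r, hra, hrd, hlb, hlc, sa, ta, sb, tb, sc, tc, sd, td⟩ := h
  exact .mk l φ m χ (r.comp e) (by simp only [hra, Quiver.Path.comp_assoc])
    (by simp only [hrd, Quiver.Path.comp_assoc]) hlb hlc _ _ _ _ _ _ _ _

/-- Equality of rewriting sequences up to Peiffer relations, that is, equality of the
corresponding `2`-cells in the free `2`-category. -/
inductive RSeq.Rel {x y : P.Obj} : {u v : P.Cell1 x y} → RSeq u v → RSeq u v → Prop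
  | refl {u v : P.Cell1 x y} (s : RSeq u v) : Rel s s
  | symm {u v : P.Cell1 x y} {s s' : RSeq u v} : Rel s s' → Rel s' s
  | trans {u v : P.Cell1 x y} {s s' s'' : RSeq u v} : Rel s s' → Rel s' s'' → Rel s s''
  | cons {u v w : P.Cell1 x y} (f : Step u v) {s s' : RSeq v w} :
      Rel s s' → Rel (RSeq.cons f s) (RSeq.cons f s')
  | peiffer {u₀ u₁ u₂ u₃ w : P.Cell1 x y} {a : Step u₀ u₁} {b : Step u₁ u₃} {c : Step u₀ u₂}
      {d : Step u₂ u₃} (h : PeifferSquare a b c d) (s : RSeq u₃ w) :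
      Rel (RSeq.cons a (RSeq.cons b s)) (RSeq.cons c (RSeq.cons d s))

theorem RSeq.Rel.append {x y : P.Obj} {u v w : P.Cell1 x y} {s s' : RSeq u v} {r r' : RSeq v w}
    (hs : RSeq.Rel s s') (hr : RSeq.Rel r r') : RSeq.Rel (s.append r) (s'.append r') := by
  have left : ∀ {u v : P.Cell1 x y} {s s' : RSeq u v}, RSeq.Rel s s' →
      ∀ {w : P.Cell1 x y} (r : RSeq v w), RSeq.Rel (s.append r) (s'.append r) := by
    intro u v s s' h
    induction h with
    | refl s => exact fun r => .refl _
    | symm _ ih => exact fun r => .symm (ih r)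
    | trans _ _ ih₁ ih₂ => exact fun r => .trans (ih₁ r) (ih₂ r)
    | cons f _ ih => exact fun r => .cons f (ih r)
    | peiffer h s => exact fun r => .peiffer h (s.append r)
  have right : ∀ {u v : P.Cell1 x y} (s : RSeq u v) {w : P.Cell1 x y} {r r' : RSeq v w},
      RSeq.Rel r r' → RSeq.Rel (s.append r) (s.append r') := by
    intro u v s
    induction s with
    | nil _ => exact fun h => h
    | cons f s ih => exact fun h => .cons f (ih h)
  exact .trans (left hs r) (right s' hr)

theorem RSeq.Rel.whiskerLeft {x y z : P.Obj} (c : P.Cell1 z x) {u v : P.Cell1 x y}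
    {s s' : RSeq u v} (h : RSeq.Rel s s') :
    RSeq.Rel (s.whiskerLeft c) (s'.whiskerLeft c) := by
  induction h with
  | refl s => exact .refl _
  | symm _ ih => exact .symm ih
  | trans _ _ ih₁ ih₂ => exact .trans ih₁ ih₂
  | cons f _ ih => exact .cons _ ih
  | peiffer h s => exact .peiffer (h.whiskerLeft c) _

theorem RSeq.Rel.whiskerRight {x y z : P.Obj} (c : P.Cell1 y z) {u v : P.Cell1 x y}
    {s s' : RSeq u v} (h : RSeq.Rel s s') :
    RSeq.Rel (s.whiskerRight c) (s'.whiskerRight c) := by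
  induction h with
  | refl s => exact .refl _
  | symm _ ih => exact .symm ih
  | trans _ _ ih₁ ih₂ => exact .trans ih₁ ih₂
  | cons f _ ih => exact .cons _ ih
  | peiffer h s => exact .peiffer (h.whiskerRight c) _

instance RSeq.setoid {x y : P.Obj} (u v : P.Cell1 x y) : Setoid (RSeq u v) :=
  ⟨RSeq.Rel, .refl, .symm, .trans⟩

/-- The `2`-cells `u ⇒ v` of the free `2`-category `Σ₂^*`. -/
def Cell2 {x y : P.Obj} (u v : P.Cell1 x y) : Type (max u v w) :=
  Quotient (RSeq.setoid u v)

namespace Cell2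

/-- The identity `2`-cell on `u`. -/
def id {x y : P.Obj} (u : P.Cell1 x y) : Cell2 u u := Quotient.mk _ (RSeq.nil u)

/-- The `1`-composition of `2`-cells. -/
def comp {x y : P.Obj} {u v w : P.Cell1 x y} : Cell2 u v → Cell2 v w → Cell2 u w :=
  Quotient.map₂ RSeq.append fun _ _ h _ _ h' => RSeq.Rel.append h h'

def whiskerLeft {x y z : P.Obj} (c : P.Cell1 z x) {u v : P.Cell1 x y} :
    Cell2 u v → Cell2 (c.comp u) (c.comp v) :=
  Quotient.map (RSeq.whiskerLeft c) fun _ _ h => RSeq.Rel.whiskerLeft c h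

def whiskerRight {x y z : P.Obj} {u v : P.Cell1 x y} (f : Cell2 u v) (c : P.Cell1 y z) :
    Cell2 (u.comp c) (v.comp c) :=
  Quotient.map (fun s => s.whiskerRight c) (fun _ _ h => RSeq.Rel.whiskerRight c h) f

end Cell2

/-- Formal composites of rewriting steps and formal inverses. -/
inductive Zigzag {x y : P.Obj} : P.Cell1 x y → P.Cell1 x y → Type (max u v w)
  | id (u : P.Cell1 x y) : Zigzag u u
  | step {u v : P.Cell1 x y} (f : Step u v) : Zigzag u v
  | comp {u v w : P.Cell1 x y} (f : Zigzag u v) (g : Zigzag v w) : Zigzag u w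
  | inv {u v : P.Cell1 x y} (f : Zigzag u v) : Zigzag v u

namespace Zigzag

def whiskerLeft {x y z : P.Obj} (c : P.Cell1 z x) {u v : P.Cell1 x y} :
    Zigzag u v → Zigzag (c.comp u) (c.comp v)
  | id u => id (c.comp u)
  | step f => step (f.whiskerLeft c)
  | comp f g => comp (whiskerLeft c f) (whiskerLeft c g)
  | inv f => inv (whiskerLeft c f)

def whiskerRight {x y z : P.Obj} {u v : P.Cell1 x y} (s : Zigzag u v) (c : P.Cell1 y z) :
    Zigzag (u.comp c) (v.comp c) :=
  match s with
  | id u => id (u.comp c)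
  | step f => step (f.whiskerRight c)
  | comp f g => comp (whiskerRight f c) (whiskerRight g c)
  | inv f => inv (whiskerRight f c)

/-- The congruence generated by the groupoid axioms (for the `1`-composition) and the Peiffer
relations. -/
inductive Rel {x y : P.Obj} : {u v : P.Cell1 x y} → Zigzag u v → Zigzag u v → Prop
  | refl {u v : P.Cell1 x y} (f : Zigzag u v) : Rel f f
  | symm {u v : P.Cell1 x y} {f g : Zigzag u v} : Rel f g → Rel g f
  | trans {u v : P.Cell1 x y} {f g h : Zigzag u v} : Rel f g → Rel g h → Rel f h
  | comp {u v w : P.Cell1 x y} {f f' : Zigzag u v} {g g' : Zigzag v w} :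
      Rel f f' → Rel g g' → Rel (Zigzag.comp f g) (Zigzag.comp f' g')
  | inv {u v : P.Cell1 x y} {f f' : Zigzag u v} :
      Rel f f' → Rel (Zigzag.inv f) (Zigzag.inv f')
  | assoc {u v w z : P.Cell1 x y} (f : Zigzag u v) (g : Zigzag v w) (h : Zigzag w z) :
      Rel (Zigzag.comp (Zigzag.comp f g) h) (Zigzag.comp f (Zigzag.comp g h))
  | id_comp {u v : P.Cell1 x y} (f : Zigzag u v) : Rel (Zigzag.comp (Zigzag.id u) f) f
  | comp_id {u v : P.Cell1 x y} (f : Zigzag u v) : Rel (Zigzag.comp f (Zigzag.id v)) f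
  | inv_comp {u v : P.Cell1 x y} (f : Zigzag u v) :
      Rel (Zigzag.comp (Zigzag.inv f) f) (Zigzag.id v)
  | comp_inv {u v : P.Cell1 x y} (f : Zigzag u v) :
      Rel (Zigzag.comp f (Zigzag.inv f)) (Zigzag.id u)
  | peiffer {u₀ u₁ u₂ u₃ : P.Cell1 x y} {a : Step u₀ u₁} {b : Step u₁ u₃} {c : Step u₀ u₂}
      {d : Step u₂ u₃} (h : PeifferSquare a b c d) :
      Rel (Zigzag.comp (Zigzag.step a) (Zigzag.step b))
        (Zigzag.comp (Zigzag.step c) (Zigzag.step d))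

theorem Rel.whiskerLeft {x y z : P.Obj} (c : P.Cell1 z x) {u v : P.Cell1 x y}
    {f g : Zigzag u v} (h : Rel f g) : Rel (f.whiskerLeft c) (g.whiskerLeft c) := by
  induction h with
  | refl s => exact .refl _
  | symm _ ih => exact .symm ih
  | trans _ _ ih₁ ih₂ => exact .trans ih₁ ih₂
  | comp _ _ ih₁ ih₂ => exact .comp ih₁ ih₂
  | inv _ ih => exact .inv ih
  | assoc f g h => exact .assoc _ _ _
  | id_comp f => exact .id_comp _
  | comp_id f => exact .comp_id _
  | inv_comp f => exact .inv_comp _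
  | comp_inv f => exact .comp_inv _
  | peiffer h => exact .peiffer (h.whiskerLeft c)

theorem Rel.whiskerRight {x y z : P.Obj} (c : P.Cell1 y z) {u v : P.Cell1 x y}
    {f g : Zigzag u v} (h : Rel f g) : Rel (f.whiskerRight c) (g.whiskerRight c) := by
  induction h with
  | refl s => exact .refl _
  | symm _ ih => exact .symm ih
  | trans _ _ ih₁ ih₂ => exact .trans ih₁ ih₂
  | comp _ _ ih₁ ih₂ => exact .comp ih₁ ih₂
  | inv _ ih => exact .inv ih
  | assoc f g h => exact .assoc _ _ _
  | id_comp f => exact .id_comp _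
  | comp_id f => exact .comp_id _
  | inv_comp f => exact .inv_comp _
  | comp_inv f => exact .comp_inv _
  | peiffer h => exact .peiffer (h.whiskerRight c)

instance setoid {x y : P.Obj} (u v : P.Cell1 x y) : Setoid (Zigzag u v) :=
  ⟨Rel, .refl, .symm, .trans⟩

end Zigzag

/-- The `2`-cells `u ⇒ v` of the free `(2,1)`-category `Σ₂^⊤`. -/
def TCell {x y : P.Obj} (u v : P.Cell1 x y) : Type (max u v w) :=
  Quotient (Zigzag.setoid u v)

namespace TCell

def id {x y : P.Obj} (u : P.Cell1 x y) : TCell u u := Quotient.mk _ (Zigzag.id u)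

def step {x y : P.Obj} {u v : P.Cell1 x y} (f : Step u v) : TCell u v :=
  Quotient.mk _ (Zigzag.step f)

/-- The `1`-composition `f ⋆₁ g`. -/
def comp {x y : P.Obj} {u v w : P.Cell1 x y} : TCell u v → TCell v w → TCell u w :=
  Quotient.map₂ Zigzag.comp fun _ _ h _ _ h' => Zigzag.Rel.comp h h'

/-- The inverse `f⁻` for the `1`-composition. -/
def inv {x y : P.Obj} {u v : P.Cell1 x y} : TCell u v → TCell v u :=
  Quotient.map Zigzag.inv fun _ _ h => Zigzag.Rel.inv h

def whiskerLeft {x y z : P.Obj} (c : P.Cell1 z x) {u v : P.Cell1 x y} :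
    TCell u v → TCell (c.comp u) (c.comp v) :=
  Quotient.map (Zigzag.whiskerLeft c) fun _ _ h => Zigzag.Rel.whiskerLeft c h

def whiskerRight {x y z : P.Obj} {u v : P.Cell1 x y} (f : TCell u v) (c : P.Cell1 y z) :
    TCell (u.comp c) (v.comp c) :=
  Quotient.map (fun s => s.whiskerRight c) (fun _ _ h => Zigzag.Rel.whiskerRight c h) f

end TCell

/-- The composite in the free `(2,1)`-category of a rewriting sequence. -/
def RSeq.toZigzag {x y : P.Obj} {u v : P.Cell1 x y} : RSeq u v → Zigzag u v
  | RSeq.nil u => Zigzag.id u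
  | RSeq.cons f s => Zigzag.comp (Zigzag.step f) s.toZigzag

def RSeq.toTCell {x y : P.Obj} {u v : P.Cell1 x y} (s : RSeq u v) : TCell u v :=
  Quotient.mk _ s.toZigzag

theorem RSeq.Rel.toZigzag {x y : P.Obj} {u v : P.Cell1 x y} {s s' : RSeq u v}
    (h : RSeq.Rel s s') : Zigzag.Rel s.toZigzag s'.toZigzag := by
  induction h with
  | refl s => exact .refl _
  | symm _ ih => exact .symm ih
  | trans _ _ ih₁ ih₂ => exact .trans ih₁ ih₂
  | cons f _ ih => exact .comp (.refl _) ih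
  | peiffer h s =>
    exact .trans (.symm (.assoc _ _ _)) (.trans (.comp (.peiffer h) (.refl _)) (.assoc _ _ _))

/-- The canonical map from the `2`-cells of `Σ₂^*` to the `2`-cells of `Σ₂^⊤`. -/
def Cell2.toTCell {x y : P.Obj} {u v : P.Cell1 x y} : Cell2 u v → TCell u v :=
  Quotient.map RSeq.toZigzag fun _ _ h => RSeq.Rel.toZigzag h

/-! ## Globular extensions and homotopy bases -/

/-- A `2`-sphere of the free `(2,1)`-category: a pair of parallel `2`-cells. -/
structure Sphere (P : TwoPolygraph.{u, v, w}) where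
  {x : P.Obj}
  {y : P.Obj}
  {u : P.Cell1 x y}
  {v : P.Cell1 x y}
  src : TCell u v
  tgt : TCell u v

/-- A globular extension of the free `(2,1)`-category: a set of `3`-cells, each with a `2`-source
and a `2`-target that form a `2`-sphere. -/
structure GlobularExtension (P : TwoPolygraph.{u, v, w}) where
  Cell : Type t
  sphere : Cell → Sphere P

namespace GlobularExtension

/-- `f ≡_Γ g`: equality of the `2`-cells `f` and `g` in the quotient of the free
`(2,1)`-category by the congruence generated by `Γ`. -/
inductive Equal (Γ : GlobularExtension.{u, v, w, t} P) :
    {x y : P.Obj} → {u v : P.Cell1 x y} → TCell u v → TCell u v → Prop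
  | gen (A : Γ.Cell) : Equal Γ (Γ.sphere A).src (Γ.sphere A).tgt
  | refl {x y : P.Obj} {u v : P.Cell1 x y} (f : TCell u v) : Equal Γ f f
  | symm {x y : P.Obj} {u v : P.Cell1 x y} {f g : TCell u v} : Equal Γ f g → Equal Γ g f
  | trans {x y : P.Obj} {u v : P.Cell1 x y} {f g h : TCell u v} :
      Equal Γ f g → Equal Γ g h → Equal Γ f h
  | comp {x y : P.Obj} {u v w : P.Cell1 x y} {f f' : TCell u v} {g g' : TCell v w} :
      Equal Γ f f' → Equal Γ g g' → Equal Γ (f.comp g) (f'.comp g')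
  | whiskerLeft {x y z : P.Obj} (c : P.Cell1 z x) {u v : P.Cell1 x y} {f g : TCell u v} :
      Equal Γ f g → Equal Γ (f.whiskerLeft c) (g.whiskerLeft c)
  | whiskerRight {x y z : P.Obj} (c : P.Cell1 y z) {u v : P.Cell1 x y} {f g : TCell u v} :
      Equal Γ f g → Equal Γ (f.whiskerRight c) (g.whiskerRight c)

/-- Formal composites of the `3`-cells of `Γ`, of identities and of inverses. The `3`-cells
`f ⇛ g` of the free `(3,1)`-category generated by `(Σ, Γ)` are the classes of these composites
modulo the axioms of `(3,1)`-categories; below, only their existence is used. -/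
inductive Cell3 (Γ : GlobularExtension.{u, v, w, t} P) :
    {x y : P.Obj} → {u v : P.Cell1 x y} → TCell u v → TCell u v → Type (max u v w t)
  | gen (A : Γ.Cell) : Cell3 Γ (Γ.sphere A).src (Γ.sphere A).tgt
  | id {x y : P.Obj} {u v : P.Cell1 x y} (f : TCell u v) : Cell3 Γ f f
  | inv {x y : P.Obj} {u v : P.Cell1 x y} {f g : TCell u v} : Cell3 Γ f g → Cell3 Γ g f
  | comp₂ {x y : P.Obj} {u v : P.Cell1 x y} {f g h : TCell u v} :
      Cell3 Γ f g → Cell3 Γ g h → Cell3 Γ f h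
  | comp₁ {x y : P.Obj} {u v w : P.Cell1 x y} {f f' : TCell u v} {g g' : TCell v w} :
      Cell3 Γ f f' → Cell3 Γ g g' → Cell3 Γ (f.comp g) (f'.comp g')
  | whiskerLeft {x y z : P.Obj} (c : P.Cell1 z x) {u v : P.Cell1 x y} {f g : TCell u v} :
      Cell3 Γ f g → Cell3 Γ (f.whiskerLeft c) (g.whiskerLeft c)
  | whiskerRight {x y z : P.Obj} (c : P.Cell1 y z) {u v : P.Cell1 x y} {f g : TCell u v} :
      Cell3 Γ f g → Cell3 Γ (f.whiskerRight c) (g.whiskerRight c)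

/-- `Γ` is a homotopy basis: every `2`-sphere of the free `(2,1)`-category is filled by a
`3`-cell of the free `(3,1)`-category generated by `Γ`. -/
def IsHomotopyBasis (Γ : GlobularExtension.{u, v, w, t} P) : Prop :=
  ∀ S : Sphere P, Nonempty (Γ.Cell3 S.src S.tgt)

end GlobularExtension

/-- Finite derivation type: the free `(2,1)`-category admits a finite homotopy basis. -/
def HasFiniteDerivationType (P : TwoPolygraph.{u, v, w}) : Prop :=
  ∃ Γ : GlobularExtension.{u, v, w, 0} P, Finite Γ.Cell ∧ Γ.IsHomotopyBasis

/-! ## Quasi-convergence -/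

def IsConfluent (P : TwoPolygraph.{u, v, w}) : Prop :=
  ∀ {x y : P.Obj} {u v w : P.Cell1 x y}, RSeq u v → RSeq u w →
    ∃ z : P.Cell1 x y, Nonempty (RSeq v z) ∧ Nonempty (RSeq w z)

def IsQuasiTerminating (P : TwoPolygraph.{u, v, w}) : Prop :=
  ∀ {x y : P.Obj} (u : ℕ → P.Cell1 x y), (∀ n, Nonempty (Step (u n) (u (n + 1)))) →
    ∃ c : P.Cell1 x y, {n | u n = c}.Infinite

def IsQuasiConvergent (P : TwoPolygraph.{u, v, w}) : Prop :=
  P.IsConfluent ∧ P.IsQuasiTerminating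

/-! ## Local branchings -/

/-- A local branching: a pair of rewriting steps with the same source. -/
structure LocalBranching (P : TwoPolygraph.{u, v, w}) where
  {x : P.Obj}
  {y : P.Obj}
  {u : P.Cell1 x y}
  {v : P.Cell1 x y}
  {w : P.Cell1 x y}
  f : Step u v
  g : Step u w

namespace LocalBranching

def swap (b : LocalBranching P) : LocalBranching P := ⟨b.g, b.f⟩

/-- The local branching `(c f d, c g d)`. -/
def whisker (b : LocalBranching P) {x' y' : P.Obj} (c : P.Cell1 x' b.x) (d : P.Cell1 b.y y') :
    LocalBranching P :=
  ⟨(b.f.whiskerLeft c).whiskerRight d, (b.g.whiskerLeft c).whiskerRight d⟩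

def IsAspherical (b : LocalBranching P) : Prop := b = ⟨b.f, b.f⟩

/-- Peiffer branchings `(f v, u g)`, in this order or in the other one. -/
def IsPeiffer (b : LocalBranching P) : Prop :=
  ∃ (x y z : P.Obj) (u u' : P.Cell1 x y) (v v' : P.Cell1 y z) (f : Step u u') (g : Step v v'),
    b = ⟨f.whiskerRight v, g.whiskerLeft u⟩ ∨ b = ⟨g.whiskerLeft u, f.whiskerRight v⟩

def IsOverlapping (b : LocalBranching P) : Prop := ¬ b.IsAspherical ∧ ¬ b.IsPeiffer

/-- The order `⊑` on local branchings. -/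
def Sub (b' b : LocalBranching P) : Prop :=
  ∃ (x' y' : P.Obj) (c : P.Cell1 x' b'.x) (d : P.Cell1 b'.y y'), b = b'.whisker c d

/-- Critical branchings: overlapping branchings which are minimal for `⊑`. -/
def IsCritical (b : LocalBranching P) : Prop :=
  b.IsOverlapping ∧ ∀ b' : LocalBranching P, b'.Sub b → b.Sub b'

end LocalBranching

/-! ## Elementary `2`-loops -/

/-- A `2`-loop of the free `2`-category `Σ₂^*`. -/
structure Loop (P : TwoPolygraph.{u, v, w}) where
  {x : P.Obj}
  {y : P.Obj}
  {u : P.Cell1 x y}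
  cell : Cell2 u u

namespace Loop

def whisker (L : Loop P) {x' y' : P.Obj} (c : P.Cell1 x' L.x) (d : P.Cell1 L.y y') : Loop P :=
  ⟨(L.cell.whiskerLeft c).whiskerRight d⟩

/-- One circular permutation of a decomposition into rewriting steps: `f ⋆₁ g` and `g ⋆₁ f`,
where `f : u ⇒ v` and `g : v ⇒ u`. -/
inductive Rotation : Loop P → Loop P → Prop
  | mk {x y : P.Obj} {u v : P.Cell1 x y} (f : Cell2 u v) (g : Cell2 v u) :
      Rotation ⟨f.comp g⟩ ⟨g.comp f⟩

/-- Equivalence of `2`-loops: the equivalence relation generated by circular permutations. -/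
def equivalence (P : TwoPolygraph.{u, v, w}) : Setoid (Loop P) := Relation.EqvGen.setoid Rotation

def IsIdentity (L : Loop P) : Prop := L.cell = Cell2.id L.u

/-- Minimality with respect to the `1`-composition. -/
def IsMinimalComp (L : Loop P) : Prop :=
  ∀ (v : P.Cell1 L.x L.y) (g : Cell2 L.u v) (h : Cell2 v v) (k : Cell2 v L.u),
    L.cell = (g.comp h).comp k → IsIdentity ⟨h⟩ ∨ (⟨h⟩ : Loop P) = L

/-- Minimality by context: `L` is not `c L' d` with `L'` a loop and `c`, `d` not both
identities. -/
def IsMinimalContext (L : Loop P) : Prop :=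
  ∀ (L' : Loop P) {x' y' : P.Obj} (c : P.Cell1 x' L'.x) (d : P.Cell1 L'.y y'),
    L = L'.whisker c d → c.length = 0 ∧ d.length = 0

/-- Elementary `2`-loops (identities are not counted as elementary). -/
def IsElementary (L : Loop P) : Prop :=
  ¬ L.IsIdentity ∧ L.IsMinimalComp ∧ L.IsMinimalContext

end Loop

/-- The set of equivalence classes of elementary `2`-loops. -/
def ElementaryLoopClass (P : TwoPolygraph.{u, v, w}) : Type (max u v w) :=
  {c : Quotient (Loop.equivalence P) //
    ∃ L : Loop P, L.IsElementary ∧ Quotient.mk (Loop.equivalence P) L = c}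

/-! ## Labellings and strict decreasingness -/

/-- A labelling of the rewriting steps by elements of `W`. -/
def Labelling (P : TwoPolygraph.{u, v, w}) (W : Type t) : Type (max u v w t) :=
  ∀ {x y : P.Obj} {u v : P.Cell1 x y}, Step u v → W

/-- The set of labels of the rewriting steps of a rewriting sequence. -/
def Labelling.labels {W : Type t} (ψ : P.Labelling W) {x y : P.Obj} {u v : P.Cell1 x y} :
    RSeq u v → Set W
  | RSeq.nil _ => ∅
  | RSeq.cons f s => {ψ f} ∪ Labelling.labels ψ s

/-- The confluence diagram `(f · f', g · g')` of the local branching `(f, g)` is strictly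
decreasing. -/
def Labelling.IsStrictDiagram {W : Type t} [PartialOrder W] (ψ : P.Labelling W) {x y : P.Obj}
    {u v w z : P.Cell1 x y} (f : Step u v) (g : Step u w) (f' : RSeq v z) (g' : RSeq w z) : Prop :=
  (∀ k ∈ ψ.labels f', k < ψ f) ∧ (∀ k ∈ ψ.labels g', k < ψ g)

/-- Every local branching has a strictly decreasing confluence diagram. -/
def Labelling.IsStrictlyDecreasing {W : Type t} [PartialOrder W] (ψ : P.Labelling W) : Prop :=
  ∀ b : LocalBranching P, ∃ (z : P.Cell1 b.x b.y) (f' : RSeq b.v z) (g' : RSeq b.w z),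
    ψ.IsStrictDiagram b.f b.g f' g'

/-- Compatibility with contexts (for strictly decreasing confluence diagrams). -/
def Labelling.IsCompatibleWithContexts {W : Type t} [PartialOrder W] (ψ : P.Labelling W) : Prop :=
  ∀ {x y : P.Obj} {u v w z : P.Cell1 x y} (f : Step u v) (g : Step u w) (f' : RSeq v z)
    (g' : RSeq w z), ψ.IsStrictDiagram f g f' g' →
    ∀ {x' y' : P.Obj} (c : P.Cell1 x' x) (d : P.Cell1 y y'),
      ψ.IsStrictDiagram ((f.whiskerLeft c).whiskerRight d) ((g.whiskerLeft c).whiskerRight d)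
        ((f'.whiskerLeft c).whiskerRight d) ((g'.whiskerLeft c).whiskerRight d)

/-- Peiffer decreasingness of a strictly decreasing labelled `2`-polygraph with respect to `Γ`:
every Peiffer branching `(f v, u g)` has a strictly decreasing confluence diagram
`(f v · f', u g · g')` with `u' g ⋆₁ (f v')⁻ ≡_Γ f' ⋆₁ g'⁻`. -/
def Labelling.IsPeifferDecreasing {W : Type*} [PartialOrder W] (ψ : P.Labelling W)
    (Γ : GlobularExtension.{u, v, w, t} P) : Prop :=
  ∀ {x y z : P.Obj} {u u' : P.Cell1 x y} {v v' : P.Cell1 y z} (f : Step u u') (g : Step v v'),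
    ∃ (c : P.Cell1 x z) (f' : RSeq (u'.comp v) c) (g' : RSeq (u.comp v') c),
      ψ.IsStrictDiagram (f.whiskerRight v) (g.whiskerLeft u) f' g' ∧
      Γ.Equal ((TCell.step (g.whiskerLeft u')).comp (TCell.step (f.whiskerRight v')).inv)
        (f'.toTCell.comp g'.toTCell.inv)

/-- The choices that make up a strictly decreasing Squier's completion: a strictly decreasing
confluence diagram for every critical branching, and a representative of every class of elementary
`2`-loops. A critical branching may be taken in either of its two orders, or in both. -/
structure StrictSquierCompletion {W : Type t} [PartialOrder W] (ψ : P.Labelling W) where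
  crit : Set (LocalBranching P)
  isCritical : ∀ b ∈ crit, b.IsCritical
  covers : ∀ b : LocalBranching P, b.IsCritical → b ∈ crit ∨ b.swap ∈ crit
  apex : ∀ b : crit, P.Cell1 b.1.x b.1.y
  left : ∀ b : crit, RSeq b.1.v (apex b)
  right : ∀ b : crit, RSeq b.1.w (apex b)
  strict : ∀ b : crit, ψ.IsStrictDiagram b.1.f b.1.g (left b) (right b)
  loop : P.ElementaryLoopClass → Loop P
  isElementary : ∀ c, (loop c).IsElementary
  loop_class : ∀ c, Quotient.mk (Loop.equivalence P) (loop c) = c.1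

/-- The globular extension of a strictly decreasing Squier's completion: the `3`-cells
`f ⋆₁ f' ⇛ g ⋆₁ g'` for the critical branchings `(f, g)`, and the `3`-cells `α ⇛ 1` for the chosen
elementary `2`-loops `α`. -/
def StrictSquierCompletion.extension {W : Type t} [PartialOrder W] {ψ : P.Labelling W}
    (S : StrictSquierCompletion ψ) : GlobularExtension.{u, v, w, max u v w} P where
  Cell := S.crit ⊕ P.ElementaryLoopClass
  sphere := Sum.elim
    (fun b => ⟨(TCell.step b.1.f).comp (S.left b).toTCell,
      (TCell.step b.1.g).comp (S.right b).toTCell⟩)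
    (fun c => ⟨(S.loop c).cell.toTCell, TCell.id (S.loop c).u⟩)

end TwoPolygraph

open CategoryTheory

namespace TwoPolygraph

variable {P : TwoPolygraph.{u, v, w}}

/-! ## The quotient of the free `(2,1)`-category by a globular extension -/

namespace TCell

variable {x y : P.Obj} {u v w z : P.Cell1 x y}

/-! Let Γ be the given Squier completion. For fixed endpoints, the 2-cells of the free
(2,1)-category modulo `≡_Γ` form a groupoid on the 1-cells; the aim is that any two parallel
morphisms in it agree.

Three facts carry the argument. Every 2-loop of the free 2-category is trivial modulo Γ, because
splitting off subloops and stripping contexts reduces it to elementary loops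
(`trivializes_of_elementary`). Every local branching has a strictly decreasing diagram that commutes
modulo Γ: critical branchings by the choice of Γ, Peiffer ones by hypothesis, the others by contexts
(`hasCoherentDiagram`). Filling local peaks with these diagrams lowers the multiset of labels, so
every morphism has the form g h⁻ with g, h rewriting sequences (`exists_seqHom_comp_inv`).

Parallel rewriting sequences r, s are then compared by prolonging both with t to a quasi-normal form
w. Write (rt)⁻(st) = g h⁻ with g, h : w ⇒ z. Some k leads back from z to w, so gk and hk are
2-loops, hence trivial, and g = h, so r = s. An arbitrary parallel pair f, g reduces to this case by
writing f g⁻ = r s⁻.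

Finally, Γ is finite. A critical branching has a source covered by the sources of its two rules, so
finitely many rules allow finitely many words and contexts; the loop cells are finite in number by
hypothesis. -/

theorem comp_assoc (f : TCell u v) (g : TCell v w) (h : TCell w z) :
    (f.comp g).comp h = f.comp (g.comp h) := by
  induction f using Quotient.ind
  induction g using Quotient.ind
  induction h using Quotient.ind
  exact Quotient.sound (.assoc _ _ _)

theorem id_comp (f : TCell u v) : (id u).comp f = f := by
  induction f using Quotient.ind
  exact Quotient.sound (.id_comp _)

theorem comp_id (f : TCell u v) : f.comp (id v) = f := by
  induction f using Quotient.ind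
  exact Quotient.sound (.comp_id _)

theorem inv_comp (f : TCell u v) : f.inv.comp f = id v := by
  induction f using Quotient.ind
  exact Quotient.sound (.inv_comp _)

theorem comp_inv (f : TCell u v) : f.comp f.inv = id u := by
  induction f using Quotient.ind
  exact Quotient.sound (.comp_inv _)

theorem comp_step_of_peifferSquare {a : Step u v} {b : Step v z} {c : Step u w} {d : Step w z}
    (h : PeifferSquare a b c d) : (step a).comp (step b) = (step c).comp (step d) :=
  Quotient.sound (.peiffer h)

end TCell

namespace GlobularExtension

variable {Γ : GlobularExtension.{u, v, w, t} P}

/-- The generating clauses of the congruence omit inverses, but f⁻ = f⁻ g g⁻ ≡ f⁻ f g⁻ = g⁻. -/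
theorem Equal.inv {x y : P.Obj} {u v : P.Cell1 x y} {f g : TCell u v} (h : Γ.Equal f g) :
    Γ.Equal f.inv g.inv := by
  have key : Γ.Equal (f.inv.comp (g.comp g.inv)) ((f.inv.comp f).comp g.inv) := by
    rw [TCell.comp_assoc]
    exact .comp (.refl _) (.comp h.symm (.refl _))
  simpa only [TCell.comp_inv, TCell.inv_comp, TCell.comp_id, TCell.id_comp] using key

/-- The `1`-cells `x → y`, as the objects of the groupoid whose morphisms are the `2`-cells of the
free `(2,1)`-category modulo `≡_Γ`. -/
structure CellGroupoid (Γ : GlobularExtension.{u, v, w, t} P) (x y : P.Obj) : Type (max u v) where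
  cell : P.Cell1 x y

variable (Γ)

/-- The relation `≡_Γ` on the `2`-cells `u ⇒ v`. -/
@[reducible]
def equalSetoid {x y : P.Obj} (u v : P.Cell1 x y) : Setoid (TCell u v) :=
  ⟨Γ.Equal, .refl, .symm, .trans⟩

instance (x y : P.Obj) : Groupoid (Γ.CellGroupoid x y) where
  Hom a b := Quotient (Γ.equalSetoid a.cell b.cell)
  id a := Quotient.mk _ (TCell.id a.cell)
  comp := Quotient.map₂ TCell.comp fun _ _ h _ _ h' => Equal.comp h h'
  inv := Quotient.map TCell.inv fun _ _ h => Equal.inv h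
  id_comp f := by
    induction f using Quotient.ind
    exact congrArg _ (TCell.id_comp _)
  comp_id f := by
    induction f using Quotient.ind
    exact congrArg _ (TCell.comp_id _)
  assoc f g h := by
    induction f using Quotient.ind
    induction g using Quotient.ind
    induction h using Quotient.ind
    exact congrArg _ (TCell.comp_assoc _ _ _)
  inv_comp f := by
    induction f using Quotient.ind
    exact congrArg _ (TCell.inv_comp _)
  comp_inv f := by
    induction f using Quotient.ind
    exact congrArg _ (TCell.comp_inv _)

/-- The class modulo `≡_Γ` of a `2`-cell of the free `(2,1)`-category. -/
def toHom {x y : P.Obj} {u v : P.Cell1 x y} (f : TCell u v) :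
    CellGroupoid.mk (Γ := Γ) u ⟶ ⟨v⟩ :=
  Quotient.mk _ f

variable {x y : P.Obj} {u v w : P.Cell1 x y}

theorem toHom_eq_iff {f g : TCell u v} : Γ.toHom f = Γ.toHom g ↔ Γ.Equal f g :=
  ⟨fun h => Quotient.exact h, fun h => Quotient.sound h⟩

/-- The class modulo `≡_Γ` of a rewriting step. -/
def stepHom (f : Step u v) : CellGroupoid.mk (Γ := Γ) u ⟶ ⟨v⟩ := Γ.toHom (TCell.step f)

/-- The class modulo `≡_Γ` of a rewriting sequence. -/
def seqHom (s : RSeq u v) : CellGroupoid.mk (Γ := Γ) u ⟶ ⟨v⟩ := Γ.toHom s.toTCell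

@[simp]
theorem seqHom_nil : Γ.seqHom (RSeq.nil u) = 𝟙 (CellGroupoid.mk u) := rfl

@[simp]
theorem seqHom_cons (f : Step u v) (s : RSeq v w) :
    Γ.seqHom (RSeq.cons f s) = Γ.stepHom f ≫ Γ.seqHom s := rfl

@[simp]
theorem seqHom_append (r : RSeq u v) (s : RSeq v w) :
    Γ.seqHom (r.append s) = Γ.seqHom r ≫ Γ.seqHom s := by
  induction r with
  | nil _ => exact (Category.id_comp (Γ.seqHom s)).symm
  | cons f r ih => rw [RSeq.append, seqHom_cons, seqHom_cons, ih, Category.assoc]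

end GlobularExtension

/-! ## Triviality of `2`-loops -/

theorem RSeq.toTCell_whiskerLeft {x y z : P.Obj} (c : P.Cell1 z x) {u v : P.Cell1 x y}
    (s : RSeq u v) : (s.whiskerLeft c).toTCell = s.toTCell.whiskerLeft c := by
  refine congrArg (Quotient.mk _) ?_
  induction s with
  | nil _ => rfl
  | cons f s ih => exact congrArg _ ih

theorem RSeq.toTCell_whiskerRight {x y z : P.Obj} (c : P.Cell1 y z) {u v : P.Cell1 x y}
    (s : RSeq u v) : (s.whiskerRight c).toTCell = s.toTCell.whiskerRight c := by
  refine congrArg (Quotient.mk _) ?_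
  induction s with
  | nil _ => rfl
  | cons f s ih => exact congrArg _ ih

namespace RSeq

/-- The number of rewriting steps of a rewriting sequence. -/
def length {x y : P.Obj} {u v : P.Cell1 x y} : RSeq u v → ℕ
  | nil _ => 0
  | cons _ s => s.length + 1

variable {x y : P.Obj} {u v w : P.Cell1 x y}

theorem length_append (r : RSeq u v) (s : RSeq v w) :
    (r.append s).length = r.length + s.length := by
  induction r with
  | nil _ => exact (Nat.zero_add _).symm
  | cons f r ih => simp only [append, length, ih]; omega

theorem length_whiskerLeft {z : P.Obj} (c : P.Cell1 z x) (s : RSeq u v) :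
    (s.whiskerLeft c).length = s.length := by
  induction s with
  | nil _ => rfl
  | cons f s ih => simp only [whiskerLeft, length, ih]

theorem length_whiskerRight {z : P.Obj} (c : P.Cell1 y z) (s : RSeq u v) :
    (s.whiskerRight c).length = s.length := by
  induction s with
  | nil _ => rfl
  | cons f s ih => simp only [whiskerRight, length, ih]

/-- Peiffer relations trade two steps for two steps, so the number of steps is defined on 2-cells of
the free 2-category and can serve as an induction measure there. -/
theorem Rel.length_eq {s s' : RSeq u v} (h : Rel s s') : s.length = s'.length := by
  induction h with
  | refl _ => rfl
  | symm _ ih => exact ih.symm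
  | trans _ _ ih₁ ih₂ => exact ih₁.trans ih₂
  | cons f _ ih => simp only [length, ih]
  | peiffer _ _ => rfl

end RSeq

namespace Cell2

variable {x y : P.Obj} {u v w : P.Cell1 x y}

/-- The number of rewriting steps of a `2`-cell of the free `2`-category. -/
def length (f : Cell2 u v) : ℕ := Quotient.lift RSeq.length (fun _ _ h => RSeq.Rel.length_eq h) f

theorem length_comp (f : Cell2 u v) (g : Cell2 v w) :
    (f.comp g).length = f.length + g.length := by
  induction f using Quotient.ind
  induction g using Quotient.ind
  exact RSeq.length_append _ _

theorem length_whisker {x' y' : P.Obj} (c : P.Cell1 x' x) (d : P.Cell1 y y') (f : Cell2 u v) :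
    ((f.whiskerLeft c).whiskerRight d).length = f.length := by
  induction f using Quotient.ind
  exact (RSeq.length_whiskerRight _ _).trans (RSeq.length_whiskerLeft _ _)

theorem eq_of_length_eq_zero (f : Cell2 u v) (h : f.length = 0) : u = v := by
  induction f using Quotient.ind with
  | _ s => cases s with
    | nil _ => rfl
    | cons _ _ => exact absurd h (Nat.succ_ne_zero _)

theorem eq_id_of_length_eq_zero (f : Cell2 u u) (h : f.length = 0) : f = id u := by
  induction f using Quotient.ind with
  | _ s => cases s with
    | nil _ => rfl
    | cons _ _ => exact absurd h (Nat.succ_ne_zero _)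

theorem id_comp (f : Cell2 u v) : (id u).comp f = f := by
  induction f using Quotient.ind
  rfl

theorem comp_id (f : Cell2 u v) : f.comp (id v) = f := by
  induction f using Quotient.ind with
  | _ s =>
    refine congrArg (Quotient.mk _) ?_
    induction s with
    | nil _ => rfl
    | cons f s ih => exact congrArg _ ih

theorem toTCell_whisker {x' y' : P.Obj} (c : P.Cell1 x' x) (d : P.Cell1 y y') (f : Cell2 u v) :
    ((f.whiskerLeft c).whiskerRight d).toTCell = (f.toTCell.whiskerLeft c).whiskerRight d := by
  induction f using Quotient.ind with
  | _ s =>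
    change ((s.whiskerLeft c).whiskerRight d).toTCell = (s.toTCell.whiskerLeft c).whiskerRight d
    rw [RSeq.toTCell_whiskerRight, RSeq.toTCell_whiskerLeft]

end Cell2

namespace GlobularExtension

variable (Γ : GlobularExtension.{u, v, w, t} P) {x y : P.Obj} {u v w : P.Cell1 x y}

/-- The class modulo `≡_Γ` of a `2`-cell of the free `2`-category. -/
def cellHom (f : Cell2 u v) : CellGroupoid.mk (Γ := Γ) u ⟶ ⟨v⟩ := Γ.toHom f.toTCell

theorem cellHom_comp (f : Cell2 u v) (g : Cell2 v w) :
    Γ.cellHom (f.comp g) = Γ.cellHom f ≫ Γ.cellHom g := by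
  induction f using Quotient.ind
  induction g using Quotient.ind
  exact Γ.seqHom_append _ _

/-- The `2`-loop `L` is trivial modulo `≡_Γ`. -/
def Trivializes (L : Loop P) : Prop := Γ.Equal L.cell.toTCell (TCell.id L.u)

theorem trivializes_iff (f : Cell2 u u) :
    Γ.Trivializes ⟨f⟩ ↔ Γ.cellHom f = 𝟙 (CellGroupoid.mk u) :=
  Γ.toHom_eq_iff.symm

theorem trivializes_of_isIdentity {L : Loop P} (h : L.IsIdentity) : Γ.Trivializes L := by
  unfold Trivializes
  rw [show L.cell = _ from h]
  exact .refl _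

/-- In a groupoid a one-sided inverse is two-sided, so f g and g f are trivial together. -/
theorem Trivializes.rotation {Γ : GlobularExtension.{u, v, w, t} P} {L L' : Loop P}
    (h : Loop.Rotation L L') : Γ.Trivializes L ↔ Γ.Trivializes L' := by
  obtain ⟨f, g⟩ := h
  simp only [trivializes_iff, cellHom_comp]
  have comm : ∀ {C : Type _} [Groupoid C] {a b : C} (i : a ⟶ b) (j : b ⟶ a), i ≫ j = 𝟙 a →
      j ≫ i = 𝟙 b := by
    intro C _ a b i j h
    rw [← Groupoid.inv_comp i, show j = Groupoid.inv i by
      rw [← Category.comp_id (Groupoid.inv i), ← h, ← Category.assoc, Groupoid.inv_comp,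
        Category.id_comp]]
  exact ⟨comm _ _, comm _ _⟩

theorem Trivializes.whisker {Γ : GlobularExtension.{u, v, w, t} P} {L : Loop P}
    (h : Γ.Trivializes L) {x' y' : P.Obj} (c : P.Cell1 x' L.x) (d : P.Cell1 L.y y') :
    Γ.Trivializes (L.whisker c d) := by
  unfold Trivializes Loop.whisker
  rw [Cell2.toTCell_whisker]
  exact .whiskerRight d (.whiskerLeft c h)

variable {Γ}

/-- Lexicographic induction on the number of steps, then the length of the source 1-cell. A loop
that is not minimal for composition is g h k with h and g k loops having fewer steps; one that is
not minimal by context keeps its steps but comes from a shorter source. -/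
theorem trivializes_of_elementary (hΓ : ∀ L : Loop P, L.IsElementary → Γ.Trivializes L) :
    ∀ (n m : ℕ) (L : Loop P), L.cell.length = n → L.u.length = m → Γ.Trivializes L := by
  intro n
  induction n using Nat.strong_induction_on with | _ n ihn
  intro m
  induction m using Nat.strong_induction_on with | _ m ihm
  rintro L hn hm
  by_cases hid : L.IsIdentity
  · exact Γ.trivializes_of_isIdentity hid
  by_cases hcomp : L.IsMinimalComp
  · by_cases hcon : L.IsMinimalContext
    · exact hΓ L ⟨hid, hcomp, hcon⟩
    · simp only [Loop.IsMinimalContext, not_forall] at hcon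
      obtain ⟨L', x', y', c, d, rfl, hcd⟩ := hcon
      refine .whisker (ihm L'.u.length ?_ L' ?_ rfl) c d
      · simp only [Loop.whisker, Quiver.Path.length_comp] at hm
        omega
      · rw [← hn]
        exact (Cell2.length_whisker _ _ _).symm
  · obtain ⟨f⟩ := L
    simp only [Loop.IsMinimalComp, not_forall, not_or] at hcomp
    obtain ⟨v, g, h, k, rfl, hh, hne⟩ := hcomp
    simp only [Cell2.length_comp] at hn
    have hpos : h.length ≠ 0 := fun h0 => hh (Cell2.eq_id_of_length_eq_zero h h0)
    -- If g and k were both empty, h would be the whole loop, which the failure of minimality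
    -- excludes.
    have hgk : g.length + k.length ≠ 0 := by
      intro h0
      obtain rfl := Cell2.eq_of_length_eq_zero g (by omega)
      rw [Cell2.eq_id_of_length_eq_zero g (by omega),
        Cell2.eq_id_of_length_eq_zero k (by omega), Cell2.id_comp, Cell2.comp_id] at hne
      exact hne rfl
    have h1 := (Γ.trivializes_iff h).1 (ihn h.length (by omega) _ ⟨h⟩ rfl rfl)
    have h2 := (Γ.trivializes_iff (g.comp k)).1
      (ihn (g.length + k.length) (by omega) _ ⟨g.comp k⟩ (Cell2.length_comp _ _) rfl)
    rw [trivializes_iff, cellHom_comp, cellHom_comp, h1, Category.comp_id, ← cellHom_comp, h2]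

end GlobularExtension

namespace StrictSquierCompletion

variable {W : Type t} [PartialOrder W] {ψ : P.Labelling W} (S : StrictSquierCompletion ψ)

/-- Γ kills one representative of each class of elementary loops, and triviality is invariant under
rotation, hence constant on classes. -/
theorem trivializes (L : Loop P) : S.extension.Trivializes L := by
  refine GlobularExtension.trivializes_of_elementary (fun L hL => ?_) _ _ L rfl rfl
  let c : P.ElementaryLoopClass := ⟨Quotient.mk _ L, L, hL, rfl⟩
  have hrel : Relation.EqvGen Loop.Rotation (S.loop c) L := Quotient.exact (S.loop_class c)
  have hiff : ∀ {L L' : Loop P}, Relation.EqvGen Loop.Rotation L L' →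
      (S.extension.Trivializes L ↔ S.extension.Trivializes L') := by
    intro L L' hrel
    induction hrel with
    | rel _ _ h => exact GlobularExtension.Trivializes.rotation h
    | refl _ => rfl
    | symm _ _ _ ih => exact ih.symm
    | trans _ _ _ _ _ ih₁ ih₂ => exact ih₁.trans ih₂
  exact (hiff hrel).1 (.gen (Γ := S.extension) (Sum.inr c))

theorem seqHom_loop {x y : P.Obj} {u : P.Cell1 x y} (s : RSeq u u) :
    S.extension.seqHom s = 𝟙 (GlobularExtension.CellGroupoid.mk u) :=
  (S.extension.trivializes_iff (Quotient.mk _ s)).1 (S.trivializes _)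

end StrictSquierCompletion

/-! ## Coherent strictly decreasing diagrams -/

namespace Labelling

variable {W : Type*} [PartialOrder W] (ψ : P.Labelling W)

/-- The local branching `b` has a strictly decreasing confluence diagram that commutes modulo
`≡_Γ`. -/
def HasCoherentDiagram (Γ : GlobularExtension.{u, v, w, t} P) (b : LocalBranching P) : Prop :=
  ∃ (z : P.Cell1 b.x b.y) (f' : RSeq b.v z) (g' : RSeq b.w z), ψ.IsStrictDiagram b.f b.g f' g' ∧
    Γ.stepHom b.f ≫ Γ.seqHom f' = Γ.stepHom b.g ≫ Γ.seqHom g'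

variable {ψ} {Γ : GlobularExtension.{u, v, w, t} P} {b : LocalBranching P}

theorem HasCoherentDiagram.swap (h : ψ.HasCoherentDiagram Γ b) : ψ.HasCoherentDiagram Γ b.swap := by
  obtain ⟨z, f', g', hs, he⟩ := h
  exact ⟨z, g', f', hs.symm, he.symm⟩

/-- Context compatibility preserves strictness, and `≡_Γ` is closed under whiskering. -/
theorem HasCoherentDiagram.whisker (hctx : ψ.IsCompatibleWithContexts)
    (h : ψ.HasCoherentDiagram Γ b) {x' y' : P.Obj} (c : P.Cell1 x' b.x) (d : P.Cell1 b.y y') :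
    ψ.HasCoherentDiagram Γ (b.whisker c d) := by
  obtain ⟨z, f', g', hs, he⟩ := h
  refine ⟨_, _, _, hctx _ _ _ _ hs c d, ?_⟩
  have key := Γ.toHom_eq_iff.1 (show Γ.toHom ((TCell.step b.f).comp f'.toTCell) =
    Γ.toHom ((TCell.step b.g).comp g'.toTCell) from he)
  have key' := (key.whiskerLeft c).whiskerRight d
  have hw : ∀ {u v w : P.Cell1 b.x b.y} (f : Step u v) (s : RSeq v w),
      (((TCell.step f).comp s.toTCell).whiskerLeft c).whiskerRight d =
        (TCell.step ((f.whiskerLeft c).whiskerRight d)).comp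
          ((s.whiskerLeft c).whiskerRight d).toTCell := by
    intro u v w f s
    rw [RSeq.toTCell_whiskerRight, RSeq.toTCell_whiskerLeft]
    rfl
  rw [hw, hw] at key'
  exact Γ.toHom_eq_iff.2 key'

theorem HasCoherentDiagram.of_isAspherical (h : b.IsAspherical) : ψ.HasCoherentDiagram Γ b := by
  rw [h]
  exact ⟨_, .nil _, .nil _, ⟨fun _ h => h.elim, fun _ h => h.elim⟩, rfl⟩

theorem peifferSquare_whisker {x y z : P.Obj} {u u' : P.Cell1 x y} {v v' : P.Cell1 y z}
    (f : Step u u') (g : Step v v') :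
    PeifferSquare (f.whiskerRight v) (g.whiskerLeft u') (g.whiskerLeft u) (f.whiskerRight v') := by
  obtain ⟨l, φ, r, rfl, rfl⟩ := f
  obtain ⟨l', χ, r', rfl, rfl⟩ := g
  exact .mk l φ (r.comp l') χ r' (by simp) (by simp) (by simp) (by simp) _ _ _ _ _ _ _ _

theorem HasCoherentDiagram.of_isPeiffer (hp : ψ.IsPeifferDecreasing Γ) (h : b.IsPeiffer) :
    ψ.HasCoherentDiagram Γ b := by
  have main : ∀ {x y z : P.Obj} {u u' : P.Cell1 x y} {v v' : P.Cell1 y z} (f : Step u u')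
      (g : Step v v'), ψ.HasCoherentDiagram Γ ⟨f.whiskerRight v, g.whiskerLeft u⟩ := by
    intro x y z u u' v v' f g
    obtain ⟨c, f', g', hs, he⟩ := hp f g
    refine ⟨c, f', g', hs, ?_⟩
    have h1 : Γ.stepHom (f.whiskerRight v) ≫ Γ.stepHom (g.whiskerLeft u') =
        Γ.stepHom (g.whiskerLeft u) ≫ Γ.stepHom (f.whiskerRight v') :=
      congrArg Γ.toHom (TCell.comp_step_of_peifferSquare (peifferSquare_whisker f g))
    have h2 : Γ.stepHom (g.whiskerLeft u') ≫ Groupoid.inv (Γ.stepHom (f.whiskerRight v')) =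
        Γ.seqHom f' ≫ Groupoid.inv (Γ.seqHom g') := Γ.toHom_eq_iff.2 he
    have h3 : Γ.seqHom f' = Γ.stepHom (g.whiskerLeft u') ≫
        Groupoid.inv (Γ.stepHom (f.whiskerRight v')) ≫ Γ.seqHom g' := by
      rw [← Category.assoc, h2, Category.assoc, Groupoid.inv_comp, Category.comp_id]
    -- The chain is fv · f' = fv · u'g · (fv')⁻ · g' = ug · fv' · (fv')⁻ · g' = ug · g', the middle
    -- equality being the Peiffer square.
    change Γ.stepHom (f.whiskerRight v) ≫ Γ.seqHom f' = Γ.stepHom (g.whiskerLeft u) ≫ Γ.seqHom g'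
    rw [h3, ← Category.assoc, h1, Category.assoc, ← Category.assoc (Γ.stepHom _)
      (Groupoid.inv _), Groupoid.comp_inv, Category.id_comp]
  obtain ⟨x, y, z, u, u', v, v', f, g, rfl | rfl⟩ := h
  · exact main f g
  · exact (main f g).swap

end Labelling

/-- The endpoints of a branching are determined by its rules and contexts, so comparing contexts
suffices and no transport along equalities of 1-cells is needed. -/
theorem LocalBranching.eq_of_components {x y : P.Obj} {u v w u' v' w' : P.Cell1 x y}
    {a b a' b' : P.Obj} {p q : P.Cell1 a b} {p' q' : P.Cell1 a' b'} {φ : P.Rule p q}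
    {χ : P.Rule p' q'} {l₁ l₁' : P.Cell1 x a} {r₁ r₁' : P.Cell1 b y} {l₂ l₂' : P.Cell1 x a'}
    {r₂ r₂' : P.Cell1 b' y} (hl₁ : l₁ = l₁') (hr₁ : r₁ = r₁') (hl₂ : l₂ = l₂') (hr₂ : r₂ = r₂')
    (s₁ : u = (l₁.comp p).comp r₁) (t₁ : v = (l₁.comp q).comp r₁)
    (s₂ : u = (l₂.comp p').comp r₂) (t₂ : w = (l₂.comp q').comp r₂)
    (s₁' : u' = (l₁'.comp p).comp r₁') (t₁' : v' = (l₁'.comp q).comp r₁')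
    (s₂' : u' = (l₂'.comp p').comp r₂') (t₂' : w' = (l₂'.comp q').comp r₂') :
    (⟨⟨l₁, φ, r₁, s₁, t₁⟩, ⟨l₂, χ, r₂, s₂, t₂⟩⟩ : LocalBranching P) =
      ⟨⟨l₁', φ, r₁', s₁', t₁'⟩, ⟨l₂', χ, r₂', s₂', t₂'⟩⟩ := by
  subst hl₁ hr₁ hl₂ hr₂ s₁ t₁ t₂ s₁' t₁' t₂'
  rfl

theorem LocalBranching.whisker_nil_nil (b : LocalBranching P) :
    b.whisker Quiver.Path.nil Quiver.Path.nil = b := by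
  obtain ⟨⟨l, φ, r, s₁, t₁⟩, ⟨l', χ, r', s₂, t₂⟩⟩ := b
  exact eq_of_components (Quiver.Path.nil_comp _) rfl (Quiver.Path.nil_comp _) rfl ..

/-- A failure of minimality gives some b' below b but not above it. Were the sources of equal
length, the contexts would be identities and b' would equal b. -/
theorem LocalBranching.exists_smaller_of_not_isCritical {b : LocalBranching P}
    (ho : b.IsOverlapping) (hc : ¬ b.IsCritical) :
    ∃ (b' : LocalBranching P) (x' y' : P.Obj) (c : P.Cell1 x' b'.x) (d : P.Cell1 b'.y y'),
      b = b'.whisker c d ∧ b'.u.length < b.u.length := by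
  simp only [IsCritical, not_and, not_forall] at hc
  obtain ⟨b', ⟨x', y', c, d, rfl⟩, hn⟩ := hc ho
  refine ⟨b', x', y', c, d, rfl, ?_⟩
  by_contra hlt
  simp only [whisker, Quiver.Path.length_comp] at hlt
  obtain rfl := c.eq_of_length_zero (by omega)
  obtain rfl := d.eq_of_length_zero (by omega)
  obtain rfl := c.eq_nil_of_length_zero (by omega)
  obtain rfl := d.eq_nil_of_length_zero (by omega)
  exact hn (by rw [whisker_nil_nil]; exact ⟨_, _, .nil, .nil, (whisker_nil_nil b').symm⟩)

namespace StrictSquierCompletion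

variable {W : Type t} [PartialOrder W] {ψ : P.Labelling W}

/-- Induction on the length of the source: a branching that is neither aspherical, Peiffer nor
critical is a whiskering of one with a shorter source. -/
theorem hasCoherentDiagram (S : StrictSquierCompletion ψ) (hctx : ψ.IsCompatibleWithContexts)
    (hp : ψ.IsPeifferDecreasing S.extension) (b : LocalBranching P) :
    ψ.HasCoherentDiagram S.extension b := by
  induction hn : b.u.length using Nat.strong_induction_on generalizing b with | _ n ih
  by_cases ha : b.IsAspherical
  · exact .of_isAspherical ha
  by_cases hpf : b.IsPeiffer
  · exact .of_isPeiffer hp hpf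
  by_cases hc : b.IsCritical
  · have main : ∀ b ∈ S.crit, ψ.HasCoherentDiagram S.extension b := fun b hb =>
      ⟨_, _, _, S.strict ⟨b, hb⟩, S.extension.toHom_eq_iff.2
        (.gen (Γ := S.extension) (Sum.inl ⟨b, hb⟩))⟩
    exact (S.covers b hc).elim (main b) fun h => (main _ h).swap
  · obtain ⟨b', _, _, c, d, rfl, hlt⟩ := b.exists_smaller_of_not_isCritical ⟨ha, hpf⟩ hc
    exact (ih _ (hn ▸ hlt) b' rfl).whisker hctx c d

end StrictSquierCompletion

/-! ## Coherent confluence by decreasingness -/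

/-- Composable lists of rewriting steps taken in either direction. -/
inductive Conversion {x y : P.Obj} : P.Cell1 x y → P.Cell1 x y → Type (max u v w)
  | nil (u : P.Cell1 x y) : Conversion u u
  | forward {u v w : P.Cell1 x y} (f : Step u v) (s : Conversion v w) : Conversion u w
  | backward {u v w : P.Cell1 x y} (f : Step v u) (s : Conversion v w) : Conversion u w

namespace Conversion

variable {x y : P.Obj} {u v w : P.Cell1 x y}

def append {u v w : P.Cell1 x y} : Conversion u v → Conversion v w → Conversion u w
  | nil _, s => s
  | forward f r, s => forward f (append r s)
  | backward f r, s => backward f (append r s)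

/-- The conversion `s ⋆₁ r`, for a rewriting sequence `s`. -/
def prependSeq {u v w : P.Cell1 x y} : RSeq u v → Conversion v w → Conversion u w
  | .nil _, r => r
  | .cons f s, r => forward f (prependSeq s r)

/-- The conversion `s⁻ ⋆₁ r`, for a rewriting sequence `s`. -/
def prependSeqInv {u v w : P.Cell1 x y} : RSeq u v → Conversion u w → Conversion v w
  | .nil _, r => r
  | .cons f s, r => prependSeqInv s (backward f r)

def reverse {u v : P.Cell1 x y} : Conversion u v → Conversion v u
  | nil u => nil u
  | forward f s => append (reverse s) (backward f (nil _))
  | backward f s => append (reverse s) (forward f (nil _))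

section Hom

variable (Γ : GlobularExtension.{u, v, w, t} P)

open GlobularExtension

/-- The class modulo `≡_Γ` of a conversion. -/
def hom {u v : P.Cell1 x y} : Conversion u v → (CellGroupoid.mk (Γ := Γ) u ⟶ ⟨v⟩)
  | nil _ => 𝟙 _
  | forward f s => Γ.stepHom f ≫ hom s
  | backward f s => Groupoid.inv (Γ.stepHom f) ≫ hom s

theorem hom_append (r : Conversion u v) (s : Conversion v w) :
    (r.append s).hom Γ = r.hom Γ ≫ s.hom Γ := by
  induction r with
  | nil _ => simp only [append, hom, Category.id_comp]
  | forward f r ih => simp only [append, hom, ih, Category.assoc]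
  | backward f r ih => simp only [append, hom, ih, Category.assoc]

theorem hom_prependSeq (s : RSeq u v) (r : Conversion v w) :
    (prependSeq s r).hom Γ = Γ.seqHom s ≫ r.hom Γ := by
  induction s with
  | nil _ => simp only [prependSeq, seqHom_nil, Category.id_comp]
  | cons f s ih => simp only [prependSeq, hom, ih, seqHom_cons, Category.assoc]

theorem hom_prependSeqInv (s : RSeq u v) (r : Conversion u w) :
    (prependSeqInv s r).hom Γ = Groupoid.inv (Γ.seqHom s) ≫ r.hom Γ := by
  induction s with
  | nil _ => simp [prependSeqInv, Groupoid.inv_eq_inv]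
  | cons f s ih => simp [prependSeqInv, hom, ih, Groupoid.inv_eq_inv]

theorem hom_reverse (s : Conversion u v) : s.reverse.hom Γ = Groupoid.inv (s.hom Γ) := by
  induction s with
  | nil _ => simp [reverse, hom, Groupoid.inv_eq_inv]
  | forward f s ih => simp [reverse, hom, hom_append, ih, Groupoid.inv_eq_inv]
  | backward f s ih => simp [reverse, hom, hom_append, ih, Groupoid.inv_eq_inv]

/-- Inverses can be pushed onto single steps; the resulting conversion has a multiset of labels to
induct on. -/
theorem exists_hom_eq (f : TCell u v) : ∃ s : Conversion u v, s.hom Γ = Γ.toHom f := by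
  induction f using Quotient.ind with | _ f
  induction f with
  | id u => exact ⟨nil u, rfl⟩
  | step f => exact ⟨forward f (nil _), Category.comp_id (Γ.stepHom f)⟩
  | comp f g ihf ihg =>
    obtain ⟨r, hr⟩ := ihf
    obtain ⟨s, hs⟩ := ihg
    exact ⟨r.append s, by rw [hom_append, hr, hs]; rfl⟩
  | inv f ih =>
    obtain ⟨r, hr⟩ := ih
    exact ⟨r.reverse, by rw [hom_reverse, hr]; rfl⟩

end Hom

section Labels

variable {W : Type*} (ψ : P.Labelling W)

/-- The multiset of the labels of a conversion. -/
def labels {u v : P.Cell1 x y} : Conversion u v → Multiset W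
  | nil _ => 0
  | forward f s => {ψ f} + labels s
  | backward f s => {ψ f} + labels s

/-- Strictness of a diagram speaks of the set of labels of a sequence, termination of the multiset
of labels of a conversion; this links the two. -/
theorem exists_labels_prependSeq (s : RSeq u v) (r : Conversion v w) :
    ∃ M : Multiset W, (prependSeq s r).labels ψ = M + r.labels ψ ∧ ∀ k ∈ M, k ∈ ψ.labels s := by
  induction s with
  | nil _ => exact ⟨0, (zero_add _).symm, by simp⟩
  | cons f s ih =>
    obtain ⟨M, hM, hk⟩ := ih r
    refine ⟨{ψ f} + M, by simp only [prependSeq, labels, hM, add_assoc], fun k h => ?_⟩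
    rw [Multiset.mem_add, Multiset.mem_singleton] at h
    exact h.imp id (hk k)

theorem exists_labels_prependSeqInv (s : RSeq u v) (r : Conversion u w) :
    ∃ M : Multiset W, (prependSeqInv s r).labels ψ = M + r.labels ψ ∧
      ∀ k ∈ M, k ∈ ψ.labels s := by
  induction s with
  | nil _ => exact ⟨0, (zero_add _).symm, by simp⟩
  | cons f s ih =>
    obtain ⟨M, hM, hk⟩ := ih (backward f r)
    refine ⟨M + {ψ f}, by simp only [prependSeqInv, labels, hM, add_assoc], fun k h => ?_⟩
    rw [Multiset.mem_add, Multiset.mem_singleton] at h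
    exact h.symm.imp id (hk k)

end Labels

end Conversion

theorem _root_.Multiset.IsDershowitzMannaLT.add_left {α : Type*} [Preorder α] {M N : Multiset α}
    (K : Multiset α) (h : M.IsDershowitzMannaLT N) : (K + M).IsDershowitzMannaLT (K + N) := by
  obtain ⟨X, Y, Z, hZ, rfl, rfl, hlt⟩ := h
  exact ⟨K + X, Y, Z, hZ, (add_assoc _ _ _).symm, (add_assoc _ _ _).symm, hlt⟩

namespace Labelling

open GlobularExtension Conversion

variable {W : Type*} [PartialOrder W] {ψ : P.Labelling W} {Γ : GlobularExtension.{u, v, w, t} P}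
  {x y : P.Obj}

/-- A conversion contains a local peak, and can then be replaced by a conversion with a smaller
multiset of labels, or it is a rewriting sequence followed by the inverse of another one. -/
theorem exists_smaller_conversion (hcoh : ∀ b, ψ.HasCoherentDiagram Γ b) {u v : P.Cell1 x y}
    (s : Conversion u v) :
    (∃ s' : Conversion u v, (s'.labels ψ).IsDershowitzMannaLT (s.labels ψ) ∧
      s'.hom Γ = s.hom Γ) ∨
    (∃ (z : P.Cell1 x y) (f : RSeq u z) (g : RSeq v z),
      s.hom Γ = Γ.seqHom f ≫ Groupoid.inv (Γ.seqHom g)) ∧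
    ((∃ g : RSeq v u, s.hom Γ = Groupoid.inv (Γ.seqHom g)) ∨
      ∃ (z : P.Cell1 x y) (f : Step u z) (r : Conversion z v), s = forward f r) := by
  -- The last clause of the statement strengthens the induction: it records how the conversion
  -- begins. Before a backward step, a tail starting with a forward step creates a peak, while a
  -- tail that is an inverse sequence absorbs that step.
  induction s with
  | nil u =>
    exact .inr ⟨⟨u, .nil u, .nil u, by simp [hom, Groupoid.inv_eq_inv]⟩,
      .inl ⟨.nil u, by simp [hom, Groupoid.inv_eq_inv]⟩⟩
  | forward f s ih =>
    obtain ⟨s', hlt, he⟩ | ⟨⟨z, h, g, he⟩, -⟩ := ih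
    · exact .inl ⟨forward f s', hlt.add_left _, by simp only [hom, he]⟩
    · exact .inr ⟨⟨z, .cons f h, g, by simp only [hom, he, seqHom_cons, Category.assoc]⟩,
        .inr ⟨_, f, s, rfl⟩⟩
  | @backward u a v f s ih =>
    obtain ⟨s', hlt, he⟩ | ⟨-, ⟨g, hg⟩ | ⟨z, g, r, rfl⟩⟩ := ih
    · exact .inl ⟨backward f s', hlt.add_left _, by simp only [hom, he]⟩
    · have key : (backward f s).hom Γ =
          Groupoid.inv (Γ.seqHom (g.append (.cons f (.nil _)))) := by
        simp [hom, hg, Groupoid.inv_eq_inv]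
      exact .inr ⟨⟨u, .nil u, _, by rw [key, seqHom_nil, Category.id_comp]⟩, .inl ⟨_, key⟩⟩
    · obtain ⟨c, f', g', hs, he⟩ := hcoh ⟨f, g⟩
      change Γ.stepHom f ≫ Γ.seqHom f' = Γ.stepHom g ≫ Γ.seqHom g' at he
      obtain ⟨M, hM, hMk⟩ := exists_labels_prependSeqInv ψ g' r
      obtain ⟨N, hN, hNk⟩ := exists_labels_prependSeq ψ f' (prependSeqInv g' r)
      -- The peak f⁻ g becomes f' g'⁻: the labels of r stay, ψ f and ψ g are removed, and those of
      -- f' and g' added lie below ψ f and ψ g respectively. Strictness is what makes the plain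
      -- multiset order sufficient.
      refine .inl ⟨prependSeq f' (prependSeqInv g' r),
        ⟨r.labels ψ, M + N, {ψ f} + {ψ g}, by simp, ?_, ?_, ?_⟩, ?_⟩
      · rw [hN, hM, add_comm N, add_assoc, add_comm M, add_assoc, add_comm M]
      · simp only [Conversion.labels]
        rw [← add_assoc, add_comm]
      · intro k hk
        rw [Multiset.mem_add] at hk
        obtain hk | hk := hk
        · exact ⟨ψ g, by simp, hs.2 k (hMk k hk)⟩
        · exact ⟨ψ f, by simp, hs.1 k (hNk k hk)⟩
      · rw [hom_prependSeq, hom_prependSeqInv]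
        simp only [hom, Groupoid.inv_eq_inv]
        rw [← Category.assoc, ← Category.assoc (inv _)]
        congr 1
        rw [IsIso.comp_inv_eq, Category.assoc, ← he, IsIso.inv_hom_id_assoc]

/-- A Church–Rosser property that holds modulo Γ: peaks are eliminated by induction on the multiset
of labels, the Dershowitz–Manna order being well founded over W. -/
theorem exists_seqHom_comp_inv [WellFoundedLT W] (hcoh : ∀ b, ψ.HasCoherentDiagram Γ b)
    {u v : P.Cell1 x y} (f : CellGroupoid.mk (Γ := Γ) u ⟶ ⟨v⟩) :
    ∃ (z : P.Cell1 x y) (g : RSeq u z) (h : RSeq v z),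
      f = Γ.seqHom g ≫ Groupoid.inv (Γ.seqHom h) := by
  obtain ⟨f, rfl⟩ := Quotient.exists_rep f
  obtain ⟨s, hs⟩ := exists_hom_eq Γ f
  rw [show Quotient.mk _ f = Γ.toHom f from rfl, ← hs]
  clear hs f
  have hwf : WellFounded (Multiset.IsDershowitzMannaLT (α := W)) :=
    Multiset.wellFounded_isDershowitzMannaLT
  induction hM : s.labels ψ using hwf.induction generalizing s with | _ M ih
  subst hM
  obtain ⟨s', hlt, he⟩ | ⟨h, -⟩ := exists_smaller_conversion hcoh s
  · rw [← he]
    exact ih _ hlt s' rfl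
  · exact h

end Labelling

/-! ## Quasi-normal forms -/

/-- The `1`-cell `u` is a quasi-normal form: whatever it rewrites into rewrites back into `u`. -/
def IsQuasiNormal {x y : P.Obj} (u : P.Cell1 x y) : Prop :=
  ∀ v : P.Cell1 x y, Nonempty (RSeq u v) → Nonempty (RSeq v u)

/-- Suppose that everything reachable from u can reach a point of no return, and let d be the least
number of steps to one. Always taking the first step of a shortest path gives an infinite sequence
along which d drops at every reversible step. By quasi-termination some 1-cell recurs, every step
between two visits is reversible, and d drops below itself. -/
theorem IsQuasiTerminating.exists_isQuasiNormal (hq : P.IsQuasiTerminating) {x y : P.Obj}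
    (u : P.Cell1 x y) : ∃ v, Nonempty (RSeq u v) ∧ IsQuasiNormal v := by
  by_contra! hcon
  let D (v : P.Cell1 x y) (n : ℕ) : Prop :=
    ∃ (z : P.Cell1 x y) (s : RSeq v z), s.length = n ∧ IsEmpty (RSeq z v)
  let d (v : P.Cell1 x y) : ℕ := sInf {n | D v n}
  have hD : ∀ v, Nonempty (RSeq u v) → D v (d v) := by
    intro v hv
    have := hcon v hv
    simp only [IsQuasiNormal, not_forall, not_nonempty_iff] at this
    obtain ⟨z, ⟨s⟩, hz⟩ := this
    exact Nat.sInf_mem (s := {n | D v n}) ⟨s.length, z, s, rfl, hz⟩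
  let B := {v : P.Cell1 x y // Nonempty (RSeq u v)}
  have next : ∀ v : B, ∃ v' : B, Nonempty (Step v.1 v'.1) ∧
      (Nonempty (RSeq v'.1 v.1) → d v'.1 < d v.1) := by
    rintro ⟨v, hv⟩
    obtain ⟨z, s, hs, hz⟩ := hD v hv
    cases s with
    | nil _ => exact (hz.false (.nil _)).elim
    | @cons _ v' _ f s =>
      refine ⟨⟨v', ⟨hv.some.append (.cons f (.nil _))⟩⟩, ⟨f⟩, fun ⟨r⟩ => ?_⟩
      -- When v' rewrites back to v, the same z is a point of no return for v': a path from z to v'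
      -- would continue to v.
      refine lt_of_le_of_lt (Nat.sInf_le (m := s.length) ⟨z, s, rfl, ⟨fun k => ?_⟩⟩) ?_
      · exact hz.false (k.append r)
      · rw [← hs]
        exact Nat.lt_succ_self _
  choose N hN hlt using next
  let a (n : ℕ) : B := N^[n] ⟨u, ⟨.nil u⟩⟩
  have ha : ∀ n, a (n + 1) = N (a n) := fun n => Function.iterate_succ_apply' _ _ _
  have hreach : ∀ m k, Nonempty (RSeq (a m).1 (a (m + k)).1) := by
    intro m k
    induction k with
    | zero => exact ⟨.nil _⟩
    | succ k ih =>
      rw [← add_assoc, ha]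
      exact ⟨ih.some.append (.cons (hN _).some (.nil _))⟩
  obtain ⟨c, hc⟩ := hq (fun n => (a n).1) fun n => by
    simp only [ha]
    exact hN _
  obtain ⟨m, hm⟩ := hc.nonempty
  obtain ⟨n, hn, hmn⟩ := hc.exists_gt m
  have hdec : ∀ k, m + k + 1 ≤ n → d (a (m + k + 1)).1 < d (a m).1 := by
    intro k hk
    have step : ∀ j, m ≤ j → j + 1 ≤ n → d (a (j + 1)).1 < d (a j).1 := by
      intro j hj hj'
      rw [ha]
      refine hlt _ ?_
      rw [← ha]
      -- The step from a j to a (j + 1) is undone by going on to a n = a m and then from a m to a j.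
      obtain ⟨i, rfl⟩ := Nat.exists_eq_add_of_le hj
      obtain ⟨i', rfl⟩ := Nat.exists_eq_add_of_le hj'
      obtain ⟨r⟩ := hreach (m + i + 1) i'
      rw [show (a (m + i + 1 + i')).1 = (a m).1 from Eq.trans hn hm.symm] at r
      exact ⟨r.append (hreach m i).some⟩
    induction k with
    | zero => exact step m le_rfl hk
    | succ k ih => exact (step (m + k + 1) (by omega) hk).trans (ih (by omega))
  obtain ⟨k, rfl⟩ := Nat.exists_eq_add_of_lt hmn
  have := hdec k le_rfl
  rw [show (a (m + k + 1)).1 = (a m).1 from Eq.trans hn hm.symm] at this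
  exact lt_irrefl _ this

/-! ## The homotopy basis -/

namespace StrictSquierCompletion

open GlobularExtension

variable {W : Type t} [PartialOrder W] [WellFoundedLT W] {ψ : P.Labelling W}

/-- Only loops made of forward steps are known to be trivial, so parallel sequences are first
extended to a quasi-normal form, from which every excursion can be closed up into such a loop. -/
theorem equal (S : StrictSquierCompletion ψ) (hq : P.IsQuasiTerminating)
    (hctx : ψ.IsCompatibleWithContexts) (hp : ψ.IsPeifferDecreasing S.extension) {x y : P.Obj}
    {u v : P.Cell1 x y} (f g : TCell u v) : S.extension.Equal f g := by
  have hcoh := S.hasCoherentDiagram hctx hp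
  have parallel : ∀ {u v : P.Cell1 x y} (r s : RSeq u v),
      S.extension.seqHom r = S.extension.seqHom s := by
    intro u v r s
    obtain ⟨w, ⟨t⟩, hw⟩ := hq.exists_isQuasiNormal v
    obtain ⟨z, g, h, he⟩ := Labelling.exists_seqHom_comp_inv hcoh
      (Groupoid.inv (S.extension.seqHom (r.append t)) ≫ S.extension.seqHom (s.append t))
    obtain ⟨k⟩ := hw z ⟨g⟩
    -- Both g k and h k are 2-loops at w, hence trivial, and k cancels on the right.
    have hgh : S.extension.seqHom g = S.extension.seqHom h := by
      have := (S.seqHom_loop (g.append k)).trans (S.seqHom_loop (h.append k)).symm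
      rw [seqHom_append, seqHom_append] at this
      exact (cancel_mono _).1 this
    refine (cancel_mono (S.extension.seqHom t)).1 ?_
    simpa [hgh, Groupoid.inv_eq_inv, eq_comm] using he
  rw [← S.extension.toHom_eq_iff]
  obtain ⟨z, r, s, he⟩ := Labelling.exists_seqHom_comp_inv hcoh
    (S.extension.toHom f ≫ Groupoid.inv (S.extension.toHom g))
  rw [parallel r s, Groupoid.comp_inv, Groupoid.inv_eq_inv] at he
  simpa using (IsIso.comp_inv_eq _).1 he

end StrictSquierCompletion

/-! ## Finiteness of the set of critical branchings -/

/-- Levi's lemma for paths, proved by peeling common last arrows. -/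
theorem _root_.Quiver.Path.exists_eq_comp_of_comp_eq_comp {V : Type*} [Quiver V] {a b c d : V}
    {p : Quiver.Path a b} {q : Quiver.Path b d} {p' : Quiver.Path a c} {q' : Quiver.Path c d}
    (h : p.comp q = p'.comp q') (hle : p.length ≤ p'.length) :
    ∃ m : Quiver.Path b c, p' = p.comp m ∧ q = m.comp q' := by
  induction q' with
  | nil => exact ⟨q, h.symm, rfl⟩
  | @cons d' d q' e ih =>
    cases q with
    | nil =>
      have := congrArg Quiver.Path.length h
      simp only [Quiver.Path.comp_nil, Quiver.Path.length_comp, Quiver.Path.length_cons] at this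
      omega
    | cons q e' =>
      simp only [Quiver.Path.comp_cons] at h
      obtain rfl := Quiver.Path.obj_eq_of_cons_eq_cons h
      obtain rfl := eq_of_heq (Quiver.Path.hom_heq_of_cons_eq_cons h)
      obtain ⟨m, rfl, rfl⟩ := ih (eq_of_heq (Quiver.Path.heq_of_cons_eq_cons h))
      exact ⟨m, rfl, rfl⟩

/-- The generating `1`-cells of a `1`-cell, the last one first. -/
def letters {x : P.Obj} : ∀ {y : P.Obj}, P.Cell1 x y → List (Σ a b : P.Obj, P.Gen a b)
  | _, .nil => []
  | _, .cons p e => ⟨_, _, e⟩ :: letters p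

theorem letters_comp {x y z : P.Obj} (p : P.Cell1 x y) (q : P.Cell1 y z) :
    letters (p.comp q) = letters q ++ letters p := by
  induction q with
  | nil => rfl
  | cons q e ih => simp only [Quiver.Path.comp_cons, letters, ih, List.cons_append]

/-- An empty list of letters forgets the object it sits at, so one endpoint must be shared; for a
context, the adjacent rule supplies it. -/
theorem letters_injective_of_target {x x' y : P.Obj} (p : P.Cell1 x y) (p' : P.Cell1 x' y)
    (h : letters p = letters p') : x = x' ∧ p ≍ p' := by
  induction p with
  | nil => cases p' with
    | nil => exact ⟨rfl, .rfl⟩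
    | cons _ _ => cases h
  | cons p e ih => cases p' with
    | nil => cases h
    | cons p' e' =>
      simp only [letters, List.cons.injEq, Sigma.mk.injEq] at h
      obtain ⟨⟨rfl, h⟩, h'⟩ := h
      obtain ⟨-, h⟩ := Sigma.mk.injEq .. ▸ eq_of_heq h
      obtain rfl := eq_of_heq h
      obtain ⟨rfl, h⟩ := ih p' h'
      obtain rfl := eq_of_heq h
      exact ⟨rfl, .rfl⟩

theorem letters_injective_of_source {x y y' : P.Obj} (p : P.Cell1 x y) (p' : P.Cell1 x y')
    (h : letters p = letters p') : y = y' ∧ p ≍ p' := by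
  have hy : y = y' := by
    cases p with
    | nil => cases p' with
      | nil => rfl
      | cons _ _ => cases h
    | cons p e => cases p' with
      | nil => cases h
      | cons p' e' =>
        simp only [letters, List.cons.injEq, Sigma.mk.injEq] at h
        obtain ⟨⟨rfl, h⟩, -⟩ := h
        exact (Sigma.mk.injEq .. ▸ eq_of_heq h).1
  subst hy
  exact ⟨rfl, (letters_injective_of_target p p' h).2⟩

namespace LocalBranching

/-- The rule and the two contexts of each of the steps of a local branching. -/
def code (b : LocalBranching P) :
    (P.AllRules × P.AllRules) ×
      (List (Σ a b : P.Obj, P.Gen a b) × List (Σ a b : P.Obj, P.Gen a b)) ×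
      List (Σ a b : P.Obj, P.Gen a b) × List (Σ a b : P.Obj, P.Gen a b) :=
  ((⟨_, _, _, _, b.f.φ⟩, ⟨_, _, _, _, b.g.φ⟩), (letters b.f.l, letters b.f.r),
    letters b.g.l, letters b.g.r)

theorem code_injective : Function.Injective (code (P := P)) := by
  rintro ⟨⟨l₁, φ, r₁, s₁, t₁⟩, ⟨l₂, χ, r₂, s₂, t₂⟩⟩
    ⟨⟨l₁', φ', r₁', s₁', t₁'⟩, ⟨l₂', χ', r₂', s₂', t₂'⟩⟩ h
  simp only [code, Prod.mk.injEq] at h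
  obtain ⟨⟨⟨⟩, ⟨⟩⟩, ⟨hl₁, hr₁⟩, hl₂, hr₂⟩ := h
  obtain ⟨rfl, h₁⟩ := letters_injective_of_target _ _ hl₁
  obtain ⟨rfl, h₂⟩ := letters_injective_of_source _ _ hr₁
  exact eq_of_components (eq_of_heq h₁) (eq_of_heq h₂)
    (eq_of_heq (letters_injective_of_target _ _ hl₂).2)
    (eq_of_heq (letters_injective_of_source _ _ hr₂).2) ..

/-- Removing a prefix c and a suffix d common to both steps gives a branching below the given one.
Minimality puts the given one below it in turn, and comparing source lengths forces c and d to be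
empty. -/
theorem IsCritical.length_eq_zero {x y x' y' : P.Obj} {u v w : P.Cell1 x y} {f : Step u v}
    {g : Step u w} (hb : (⟨f, g⟩ : LocalBranching P).IsCritical) {c : P.Cell1 x x'}
    {d : P.Cell1 y' y} {l₁ : P.Cell1 x' f.a} {r₁ : P.Cell1 f.b y'} {l₂ : P.Cell1 x' g.a}
    {r₂ : P.Cell1 g.b y'} (hl₁ : f.l = c.comp l₁) (hr₁ : f.r = r₁.comp d)
    (hl₂ : g.l = c.comp l₂) (hr₂ : g.r = r₂.comp d) : c.length = 0 ∧ d.length = 0 := by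
  obtain ⟨_, φ, _, rfl, rfl⟩ := f
  obtain ⟨_, χ, _, hs, rfl⟩ := g
  dsimp only at hl₁ hr₁ hl₂ hr₂ l₁ l₂ r₁ r₂
  subst hl₁ hr₁ hl₂ hr₂
  rename_i p q _ _ p' q'
  have hs' : (l₁.comp p).comp r₁ = (l₂.comp p').comp r₂ := by
    apply c.comp_injective_right
    apply d.comp_injective_left
    simpa only [Quiver.Path.comp_assoc] using hs
  have hsub := hb.2 ⟨⟨l₁, φ, r₁, rfl, rfl⟩, ⟨l₂, χ, r₂, hs', rfl⟩⟩
    ⟨_, _, c, d, eq_of_components rfl rfl rfl rfl ..⟩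
  obtain ⟨_, _, c', d', h⟩ := hsub
  have hlen := congrArg (fun b : LocalBranching P => b.u.length) h
  simp only [whisker, Quiver.Path.length_comp] at hlen
  omega

/-- A prefix p and a suffix p' of one word either leave a gap m, possibly empty, or overlap and
together cover the word. -/
theorem exists_eq_comp_or_letters_le {x a b y : P.Obj} {p : P.Cell1 x a} {r : P.Cell1 a y}
    {l : P.Cell1 x b} {p' : P.Cell1 b y} (h : p.comp r = l.comp p') :
    (∃ m : P.Cell1 a b, l = p.comp m ∧ r = m.comp p') ∨
      (letters (p.comp r)).length ≤ (letters p ++ letters p').length ∧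
        letters (p.comp r) ⊆ letters p ++ letters p' := by
  by_cases hle : p.length ≤ l.length
  · exact .inl (Quiver.Path.exists_eq_comp_of_comp_eq_comp h hle)
  · obtain ⟨m, rfl, rfl⟩ := Quiver.Path.exists_eq_comp_of_comp_eq_comp h.symm (by omega)
    refine .inr ⟨?_, ?_⟩
    · simp only [letters_comp, List.length_append]
      omega
    · intro e
      simp only [letters_comp, List.mem_append]
      tauto

/-- The shorter left context is a prefix of both, so it is empty by minimality; likewise on the
right. Thus either one rule spans the whole source, or one rule begins it and the other ends it, and
then disjoint factors would make the branching Peiffer. -/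
theorem IsCritical.letters_le {x y : P.Obj} {u v w : P.Cell1 x y} {f : Step u v} {g : Step u w}
    (hb : (⟨f, g⟩ : LocalBranching P).IsCritical) :
    (letters u).length ≤ (letters f.p ++ letters g.p).length ∧
      letters u ⊆ letters f.p ++ letters g.p := by
  have hl : f.l.length = 0 ∨ g.l.length = 0 := by
    have h : f.l.comp (f.p.comp f.r) = g.l.comp (g.p.comp g.r) := by
      rw [← Quiver.Path.comp_assoc, ← Quiver.Path.comp_assoc, ← f.src_eq, ← g.src_eq]
    obtain hle | hle := le_total f.l.length g.l.length
    · obtain ⟨m, hm, -⟩ := Quiver.Path.exists_eq_comp_of_comp_eq_comp h hle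
      exact .inl (hb.length_eq_zero (c := f.l) (d := .nil) (l₁ := .nil) rfl rfl hm rfl).1
    · obtain ⟨m, hm, -⟩ := Quiver.Path.exists_eq_comp_of_comp_eq_comp h.symm hle
      exact .inr (hb.length_eq_zero (c := g.l) (d := .nil) (l₂ := .nil) hm rfl rfl rfl).1
  have hr : f.r.length = 0 ∨ g.r.length = 0 := by
    have h : (f.l.comp f.p).comp f.r = (g.l.comp g.p).comp g.r := f.src_eq.symm.trans g.src_eq
    obtain hle | hle := le_total (f.l.comp f.p).length (g.l.comp g.p).length
    · obtain ⟨m, -, hm⟩ := Quiver.Path.exists_eq_comp_of_comp_eq_comp h hle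
      exact .inr (hb.length_eq_zero (c := .nil) (d := g.r) (r₂ := .nil)
        (Quiver.Path.nil_comp _).symm hm (Quiver.Path.nil_comp _).symm
        (Quiver.Path.nil_comp _).symm).2
    · obtain ⟨m, -, hm⟩ := Quiver.Path.exists_eq_comp_of_comp_eq_comp h.symm hle
      exact .inl (hb.length_eq_zero (c := .nil) (d := f.r) (r₁ := .nil)
        (Quiver.Path.nil_comp _).symm (Quiver.Path.nil_comp _).symm
        (Quiver.Path.nil_comp _).symm hm).2
  obtain ⟨l₁, φ, r₁, rfl, rfl⟩ := f
  obtain ⟨l₂, χ, r₂, hs, rfl⟩ := g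
  rename_i a₁ b₁ p₁ q₁ a₂ b₂ p₂ q₂
  dsimp only at hl hr ⊢
  obtain hl | hl := hl
  · obtain rfl := l₁.eq_of_length_zero hl
    obtain rfl := l₁.eq_nil_of_length_zero hl
    rw [Quiver.Path.nil_comp] at hs ⊢
    obtain hr | hr := hr
    · obtain rfl := r₁.eq_of_length_zero hr
      obtain rfl := r₁.eq_nil_of_length_zero hr
      simp
    · obtain rfl := r₂.eq_of_length_zero hr
      obtain rfl := r₂.eq_nil_of_length_zero hr
      refine (exists_eq_comp_or_letters_le (l := l₂) (p' := p₂) hs).resolve_left ?_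
      rintro ⟨m, rfl, rfl⟩
      -- The gap m between the two factors is put into the right context of the first step,
      -- exhibiting a Peiffer branching.
      refine hb.1.2 ⟨_, _, _, _, _, _, _, ⟨.nil, φ, m, rfl, rfl⟩, ⟨.nil, χ, .nil, rfl, rfl⟩,
        .inl (eq_of_components rfl ?_ ?_ rfl ..)⟩ <;> simp
  · obtain rfl := l₂.eq_of_length_zero hl
    obtain rfl := l₂.eq_nil_of_length_zero hl
    rw [hs]
    rw [Quiver.Path.nil_comp] at hs ⊢
    obtain hr | hr := hr
    · obtain rfl := r₁.eq_of_length_zero hr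
      obtain rfl := r₁.eq_nil_of_length_zero hr
      have := (exists_eq_comp_or_letters_le (l := l₁) (p' := p₁) hs.symm).resolve_left ?_
      · refine ⟨this.1.trans (by simp [add_comm]), List.Subset.trans this.2 (by simp)⟩
      rintro ⟨m, rfl, rfl⟩
      refine hb.1.2 ⟨_, _, _, _, _, _, _, ⟨.nil, χ, m, rfl, rfl⟩, ⟨.nil, φ, .nil, rfl, rfl⟩,
        .inr (eq_of_components ?_ rfl rfl ?_ ..)⟩ <;> simp
    · obtain rfl := r₂.eq_of_length_zero hr
      obtain rfl := r₂.eq_nil_of_length_zero hr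
      simp

theorem finite_isCritical [Finite P.AllRules] : {b : LocalBranching P | b.IsCritical}.Finite := by
  let T (R : P.AllRules × P.AllRules) : Set (List (Σ a b : P.Obj, P.Gen a b)) :=
    {L | L.length ≤ (letters R.1.2.2.1 ++ letters R.2.2.2.1).length ∧
      L ⊆ letters R.1.2.2.1 ++ letters R.2.2.2.1}
  have hT : ∀ R, (T R).Finite := by
    intro R
    set K := letters R.1.2.2.1 ++ letters R.2.2.2.1 with hK
    have : Finite {e // e ∈ K} := K.finite_toSet.to_subtype
    -- Words of bounded length over the finite alphabet of letters occurring in K.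
    refine ((List.finite_length_le {e // e ∈ K} K.length).image (List.map Subtype.val)).subset ?_
    rintro L ⟨hlen, hsub⟩
    exact ⟨L.attachWith (· ∈ K) fun _ h => hsub h, (List.length_attachWith ..).trans_le hlen, List.attachWith_map_subtype_val _⟩
  have hfin : (⋃ R : P.AllRules × P.AllRules, {R} ×ˢ ((T R ×ˢ T R) ×ˢ (T R ×ˢ T R))).Finite :=
    Set.finite_iUnion fun R => (Set.finite_singleton R).prod
      (((hT R).prod (hT R)).prod ((hT R).prod (hT R)))
  refine Set.Finite.of_injOn (f := code) ?_ code_injective.injOn hfin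
  rintro @⟨x, y, u, v, w, f, g⟩ hb
  have hu := IsCritical.letters_le hb
  have key : ∀ L L' L'' : List (Σ a b : P.Obj, P.Gen a b), L ++ (L' ++ L'') = letters u →
      L ∈ T ((⟨_, _, _, _, f.φ⟩, ⟨_, _, _, _, g.φ⟩)) ∧
        L'' ∈ T ((⟨_, _, _, _, f.φ⟩, ⟨_, _, _, _, g.φ⟩)) := by
    intro L L' L'' h
    rw [← h] at hu
    simp only [List.length_append, List.append_subset] at hu
    refine ⟨⟨?_, hu.2.1⟩, ⟨?_, hu.2.2.2⟩⟩ <;> simp only [List.length_append] <;> omega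
  -- The right context comes first because `letters` lists the last generator first.
  have h₁ := key (letters f.r) (letters f.p) (letters f.l)
    (by rw [← letters_comp, ← letters_comp, ← f.src_eq])
  have h₂ := key (letters g.r) (letters g.p) (letters g.l)
    (by rw [← letters_comp, ← letters_comp, ← g.src_eq])
  exact Set.mem_iUnion.2 ⟨_, rfl, ⟨h₁.2, h₁.1⟩, h₂.2, h₂.1⟩

end LocalBranching

/-! ### From the congruence to a finite homotopy basis -/

namespace GlobularExtension

variable {Γ : GlobularExtension.{u, v, w, t} P}

theorem nonempty_cell3_of_equal {Γ' : GlobularExtension.{u, v, w, 0} P}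
    (hΓ : ∀ A : Γ.Cell, ∃ B : Γ'.Cell, Γ'.sphere B = Γ.sphere A) {x y : P.Obj} {u v : P.Cell1 x y}
    {f g : TCell u v} (h : Γ.Equal f g) : Nonempty (Γ'.Cell3 f g) := by
  induction h with
  | gen A =>
    obtain ⟨B, hB⟩ := hΓ A
    rw [← hB]
    exact ⟨.gen B⟩
  | refl f => exact ⟨.id f⟩
  | symm _ ih => exact ih.map .inv
  | trans _ _ ih₁ ih₂ => exact ⟨.comp₂ ih₁.some ih₂.some⟩
  | comp _ _ ih₁ ih₂ => exact ⟨.comp₁ ih₁.some ih₂.some⟩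
  | whiskerLeft c _ ih => exact ih.map (.whiskerLeft c)
  | whiskerRight c _ ih => exact ih.map (.whiskerRight c)

/-- Finite derivation type asks for an index type in the lowest universe, so the finite set of cells
is reindexed by `Fin n`. -/
theorem hasFiniteDerivationType [Finite Γ.Cell]
    (h : ∀ {x y : P.Obj} {u v : P.Cell1 x y} (f g : TCell u v), Γ.Equal f g) :
    P.HasFiniteDerivationType := by
  obtain ⟨n, ⟨e⟩⟩ := Finite.exists_equiv_fin Γ.Cell
  refine ⟨⟨Fin n, fun i => Γ.sphere (e.symm i)⟩, inferInstanceAs (Finite (Fin n)), fun S => ?_⟩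
  exact nonempty_cell3_of_equal (Γ := Γ)
    (fun A => ⟨e A, congrArg Γ.sphere (e.symm_apply_apply A)⟩) (h S.src S.tgt)

end GlobularExtension

end TwoPolygraph

theorem mainTheorem4 (P : TwoPolygraph.{u, v, w}) {W : Type t} [PartialOrder W] [WellFoundedLT W]
    (ψ : P.Labelling W) (hdec : ψ.IsStrictlyDecreasing) (hqc : P.IsQuasiConvergent)
    (hctx : ψ.IsCompatibleWithContexts) (S : TwoPolygraph.StrictSquierCompletion ψ)
    (hpeiffer : ψ.IsPeifferDecreasing S.extension)
    (hrules : Finite P.AllRules) (hloops : Finite P.ElementaryLoopClass) :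
    P.HasFiniteDerivationType := by
  have hcrit : Finite S.crit :=
    (TwoPolygraph.LocalBranching.finite_isCritical.subset S.isCritical).to_subtype
  have hcell : Finite S.extension.Cell := inferInstanceAs (Finite (S.crit ⊕ P.ElementaryLoopClass))
  exact S.extension.hasFiniteDerivationType (S.equal hqc.2 hctx hpeiffer)
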